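/- **Setting.** For every $I=0,1,2,\dots$ let a matched study with $I$ sets be given. Set $i$ has $n_i\ge 2$ units, exactly one of which is treated; potential outcomes are fixed and only the assignment $Z$ is random, with $P(Z=z)=\prod_{i}\prod_{j}(p^\star_{ij})^{z_{ij}}$, $p^\star_{ij}\ge0$, $\sum_j p^\star_{ij}=1$. The hidden bias of set $i$ is $\Gamma_i^\star=\max_j p^\star_{ij}/\min_j p^\star_{ij}\in[1,\infty]$ ($\infty$ if the minimum is $0$), and $\Gamma^\star=(\Gamma_1^\star,\dots,\Gamma_I^\star)$. For $\Gamma\in[1,\infty]^I$ let $\Gamma_{(1)}\le\dots\le\Gamma_{(I)}$ be its ordered coordinates and $I_\Gamma(\Gamma_0)=\#\{i:\Gamma_i>\Gamma_0\}$; write $I^\star(\Gamma_0)=I_{\Gamma^\star}(\Gamma_0)$. Put $\mathcal S_{\Gamma_0;k}=\{\Gamma\in[1,\infty]^I:\Gamma_{(k)}\le\Gamma_0\}$, with complement $\mathcal S^{c}_{\Gamma_0;k}$ in $[1,\infty]^I$. **Statistic and bounds.** The scores $q_{ij}$ are arbitrary functions of the control potential outcome vector, $T=\sum_{i,j}Z_{ij}q_{ij}$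 and $T_i=\sum_j Z_{ij}q_{ij}$; in $T$ and in the $p$-values below they are computed from the observed outcomes, which under Fisher's null $H_0$ (treatment and control potential outcomes are equal for all units) coincide with the control potential outcomes. Let $R_i=\max_jq_{ij}-\min_jq_{ij}$, and let $\mu_i,v_i^2$ be the true mean and variance of $T_i$. For $x\in[1,\infty]$ let $\mu_i(x)$ be the maximal mean of $T_i$ over the laws $P(Z_{ij}=1)=x^{u_j}/\sum_l x^{u_l}$, $u\in[0,1]^{n_i}$ (all laws if $x=\infty$), and $v_i^2(x)$ the maximal variance among the laws that maximize the mean. For $\mathcal I\subseteq\{1,\dots,I\}$ let $\mu(\Gamma_0;\mathcal I)=\sum_{i\in\mathcal I}\mu_i(\Gamma_0)+\sum_{i\notin\mathcal I}\mu_i(\infty)$ and $\sigma^2(\Gamma_0;\mathcal I)=\sum_{i\in\mathcal I}v_i^2(\Gamma_0)+\sum_{i\notin\mathcal I}v_i^2(\infty)$; let $\mu(\Gamma_0;k)=\max_{|\mathcal I|=k}\mu(\Gamma_0;\mathcal I)$, and let $\sigma^2(\Gamma_0;k)$ be the maximum of $\sigma^2(\Gamma_0;\mathcal I)$ over the maximizers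 $\mathcal I$ of $\mu(\Gamma_0;\cdot)$ with $|\mathcal I|=k$. **Modified $p$-value.** Given sequences $\underline k_I$ and $\overline\Gamma_I$, let $\tilde{\tilde p}_{\Gamma_0;k}=P\{N\ge t\}|_{t=T}$ with $N\sim\mathcal N(\mu(\Gamma_0;k),\sigma^2(\Gamma_0;k))$ if $\Gamma_0\le\overline\Gamma_I$, $k\ge\max(1,\underline k_I)$ and $T\ge\mu(\Gamma_0;k)$, and $\tilde{\tilde p}_{\Gamma_0;k}=1$ otherwise. Here $\Gamma_0\in[1,\infty]$ and $0\le k\le I$. **Condition A5.** Let $\mathcal I_k^\star$ be a set of $k$ indices with the smallest $\Gamma_i^\star$. Let $\mathcal I_{\Gamma_0;k}$ be a set of the $k$ lowest-ranked indices when the indices are ranked by $\mu_i(\infty)-\mu_i(\Gamma_0)$ and ties by decreasing $v_i^2(\Gamma_0)$ (remaining ties arbitrarily). For $\Gamma\in[1,\infty]^I$ let $\mathcal A_\Gamma=\{i:v_i^2>v_i^2(\Gamma_i)\}$, and let $\Delta_\mu(\Gamma)$, $\Delta_{v^2}(\Gamma)$ be the averages over $\mathcal A_\Gamma$ of $\mu_i(\Gamma_i)-\mu_i$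 and $v_i^2-v_i^2(\Gamma_i)$. Let $\mathcal B_k(\Gamma_0)$ be the set of pairs $(i,j)$ with $i\in\mathcal I_{\Gamma_0;k}\setminus\mathcal I_k^\star$, $j\in\mathcal I_k^\star\setminus\mathcal I_{\Gamma_0;k}$ and $v_i^2(\Gamma_0)<v_j^2(\Gamma_0)$, and let $\Delta_\mu(\Gamma_0;k)$, $\Delta_{v^2}(\Gamma_0;k)$ be the averages over $\mathcal B_k(\Gamma_0)$ of $\{\mu_j(\infty)-\mu_j(\Gamma_0)\}-\{\mu_i(\infty)-\mu_i(\Gamma_0)\}$ and $v_j^2(\Gamma_0)-v_i^2(\Gamma_0)$. The condition is that, as $I\to\infty$, (i) $\max_iR_i^2/\{\sum_iR_i^2/(n_i\Gamma_i^\star)^3\}\to0$; (ii) $\inf\ \dfrac{\Delta_\mu(\Gamma^{(k)})}{\Delta_{v^2}(\Gamma^{(k)})}\sqrt{\sum_{i=1}^IR_i^2/(n_i\Gamma_i^\star)^3}\to\infty$, where $\Gamma^{(k)}$ equals $\Gamma_0$ on $\mathcal I_k^\star$ and $\infty$ elsewhere; (iii) $\inf\ \dfrac{\Delta_\mu(\Gamma_0;k)}{\Delta_{v^2}(\Gamma_0;k)}\sqrt{\sum_{i\in\mathcal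 I_k^\star}R_i^2/(n_i\Gamma_0)^3}\to\infty$. Both infima are over $\max(1,\underline k_I)\le k\le I$ and $\Gamma_0\in[\Gamma_{(k)}^\star,\overline\Gamma_I]$, and the expression in (ii), respectively (iii), is $\infty$ if $\mathcal A_{\Gamma^{(k)}}$, respectively $\mathcal B_k(\Gamma_0)$, is empty. (In (i), $0/0=0$.) **Theorem A1.** Assume that Fisher's null $H_0$ and Condition A5 hold, and let $\alpha\in(0,1)$. View the confidence sets for $\Gamma^\star_{(k)}$ and for $I^\star(\Gamma_0)$ as the confidence sets $\bigcap_{\Gamma_0:\tilde{\tilde p}_{\Gamma_0;k}\le\alpha}\mathcal S^c_{\Gamma_0;k}$ and $\bigcap_{k:\tilde{\tilde p}_{\Gamma_0;k}\le\alpha}\mathcal S^c_{\Gamma_0;k}$ for $\Gamma^\star$, i.e. as the sets of bias vectors that belong to no rejected null hypothesis. Then: 1. For every $I$ and every realized assignment, the intersection of all confidence sets for the $\Gamma^\star_{(k)}$ is the same as that of all confidence sets for the $I^\star(\Gamma_0)$: $$\bigcap_{k=1}^I\ \bigcap_{\Gamma_0:\tilde{\tilde p}_{\Gamma_0;k}\le\alpha}\mathcal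 S^c_{\Gamma_0;k}=\bigcap_{\Gamma_0\ge1}\ \bigcap_{k:\tilde{\tilde p}_{\Gamma_0;k}\le\alpha}\mathcal S^c_{\Gamma_0;k}=\bigcap_{\Gamma_0,k:\tilde{\tilde p}_{\Gamma_0;k}\le\alpha}\mathcal S^c_{\Gamma_0;k}.$$ 2. For $1\le k\le I$, every $\Gamma$ in the confidence set for $\Gamma^\star_{(k)}$ satisfies $\Gamma_{(k)}\in\{\Gamma_0\ge1:\tilde{\tilde p}_{\Gamma_0;k}>\alpha\}$, and the converse holds whenever the realized $\tilde{\tilde p}_{\Gamma_0;k}$ is nondecreasing in $\Gamma_0$. For $\Gamma_0\ge1$, every $\Gamma$ in the confidence set for $I^\star(\Gamma_0)$ satisfies $I_\Gamma(\Gamma_0)\in\{I-k:\tilde{\tilde p}_{\Gamma_0;k}>\alpha,\ 0\le k\le I\}$, and the converse holds whenever the realized $\tilde{\tilde p}_{\Gamma_0;k}$ is nonincreasing in $k\in\{0,\dots,I\}$. 3. The set in 1 is an asymptotic $1-\alpha$ confidence set for the whole vector of true hidden biases: $$\liminf_{I\to\infty}P\Big(\Gamma^\star\in\bigcap_{\Gamma_0,k:\tilde{\tilde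 p}_{\Gamma_0;k}\le\alpha}\mathcal S^c_{\Gamma_0;k}\Big)\ge1-\alpha.$$ -/

import Mathlib

open Filter Topology
open scoped ENNReal BigOperators

noncomputable section

/-- The range `[1, ∞]` of possible hidden biases. -/
abbrev Bias : Type := Set.Ici (1 : ℝ≥0∞)

/-- The infinite hidden bias. -/
def infBias : Bias := ⟨⊤, Set.mem_Ici.2 le_top⟩

/-- `I*(Γ₀)` for a bias vector: the number of coordinates strictly greater than `Γ₀`. -/
def exceedCount {I : ℕ} (Γ : Fin I → Bias) (Γ₀ : Bias) : ℕ :=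
  (Finset.univ.filter (fun i => Γ₀ < Γ i)).card

/-- `Γ_(k)`: the `k`-th smallest coordinate, `1 ≤ k ≤ I`, with the convention `Γ_(0) = 1`. -/
def orderStat {I : ℕ} (Γ : Fin I → Bias) (k : ℕ) : Bias :=
  if h : 1 ≤ k ∧ k ≤ I then Γ (Tuple.sort Γ ⟨k - 1, by omega⟩) else ⟨1, Set.self_mem_Ici⟩

/-- `S_{Γ₀;k}`: the bias vectors in `[1, ∞]^I` whose coordinate at rank `k` is at most `Γ₀`. -/
def nullSet (I : ℕ) (Γ₀ : Bias) (k : ℕ) : Set (Fin I → Bias) :=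
  {Γ | orderStat Γ k ≤ Γ₀}

/-! ### One matched set -/

/-- The mean of a score that equals `q j` with probability `p j`. -/
def lawMean {n : ℕ} (p q : Fin n → ℝ) : ℝ := ∑ j, p j * q j

/-- The variance of a score that equals `q j` with probability `p j`. -/
def lawVar {n : ℕ} (p q : Fin n → ℝ) : ℝ := ∑ j, p j * (q j - lawMean p q) ^ 2

/-- The laws of the treated unit of a set of `n` units under a sensitivity model with hidden bias
`Γ` and some hidden confounding `u ∈ [0,1]^n`: the unit `j` is treated with probability
`exp (γ u_j) / ∑ l, exp (γ u_l)`, `γ = log Γ`.  An infinite bias imposes no constraint. -/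
def sensitivityLaws (n : ℕ) (Γ : Bias) : Set (Fin n → ℝ) :=
  {p | p ∈ stdSimplex ℝ (Fin n) ∧ ((Γ : ℝ≥0∞) ≠ ⊤ → ∃ u : Fin n → ℝ,
    (∀ j, u j ∈ Set.Icc (0 : ℝ) 1) ∧
    ∀ j, p j = Real.exp (Real.log (Γ : ℝ≥0∞).toReal * u j) /
      ∑ l, Real.exp (Real.log (Γ : ℝ≥0∞).toReal * u l))}

/-- `μ_i(Γ)`: the maximal mean over the sensitivity models with bias `Γ`. -/
def maxMean {n : ℕ} (q : Fin n → ℝ) (Γ : Bias) : ℝ :=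
  sSup {m | ∃ p ∈ sensitivityLaws n Γ, m = lawMean p q}

/-- `v_i²(Γ)`: the maximal variance over the sensitivity models with bias `Γ` that maximize the
mean. -/
def maxVar {n : ℕ} (q : Fin n → ℝ) (Γ : Bias) : ℝ :=
  sSup {v | ∃ p ∈ sensitivityLaws n Γ, lawMean p q = maxMean q Γ ∧ v = lawVar p q}

/-- `R_i`: the range of the scores of a set. -/
def scoreRange {n : ℕ} (q : Fin n → ℝ) : ℝ := (⨆ j, q j) - ⨅ j, q j

/-- The bias of a law: the largest ratio of two treatment probabilities in the set, `∞` if some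
unit has probability zero. -/
def lawBias {n : ℕ} (p : Fin n → ℝ) : ℝ≥0∞ :=
  (⨆ j, ENNReal.ofReal (p j)) / ⨅ j, ENNReal.ofReal (p j)

theorem one_le_lawBias {n : ℕ} (p : Fin n → ℝ) (h : ∑ j, p j = 1) : 1 ≤ lawBias p := by
  have hne : ∃ j, 0 < p j := by
    by_contra hcon
    push Not at hcon
    have := Finset.sum_nonpos (fun j (_ : j ∈ Finset.univ) => hcon j)
    linarith
  obtain ⟨j, hj⟩ := hne
  have htop : (⨅ j, ENNReal.ofReal (p j)) ≠ ⊤ :=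
    ne_top_of_le_ne_top ENNReal.ofReal_ne_top (iInf_le _ j)
  have hpos : (⨆ j, ENNReal.ofReal (p j)) ≠ 0 := by
    have h1 := le_iSup (fun j => ENNReal.ofReal (p j)) j
    have h2 : 0 < ENNReal.ofReal (p j) := ENNReal.ofReal_pos.2 hj
    exact (lt_of_lt_of_le h2 h1).ne'
  unfold lawBias
  rw [ENNReal.le_div_iff_mul_le (Or.inr hpos) (Or.inl htop), one_mul]
  exact (iInf_le _ j).trans (le_iSup (fun j => ENNReal.ofReal (p j)) j)

/-! ### Bounds on the mean and the variance of the statistic, for given scores -/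

/-- An array of scores `q_{ij}`, `j` ranging over the `n i` units of the set `i`. -/
abbrev Scores {I : ℕ} (n : Fin I → ℕ) : Type := (i : Fin I) → Fin (n i) → ℝ

/-- The bias vector equal to `Γ₀` on `s` and to `∞` outside `s`. -/
def boundOn {I : ℕ} (Γ₀ : Bias) (s : Finset (Fin I)) : Fin I → Bias :=
  fun i => if i ∈ s then Γ₀ else infBias

/-- `μ(Γ)` for a vector `Γ` of set-specific bounds. -/
def vecMean {I : ℕ} {n : Fin I → ℕ} (q : Scores n) (Γ : Fin I → Bias) : ℝ :=
  ∑ i, maxMean (q i) (Γ i)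

/-- `σ²(Γ)` for a vector `Γ` of set-specific bounds. -/
def vecVar {I : ℕ} {n : Fin I → ℕ} (q : Scores n) (Γ : Fin I → Bias) : ℝ :=
  ∑ i, maxVar (q i) (Γ i)

/-- `μ(Γ₀; k)`: the maximum of `μ(Γ₀; s)` over the sets `s` of `k` indices. -/
def quantMean {I : ℕ} {n : Fin I → ℕ} (q : Scores n) (Γ₀ : Bias) (k : ℕ) : ℝ :=
  sSup {m | ∃ s : Finset (Fin I), s.card = k ∧ m = vecMean q (boundOn Γ₀ s)}

/-- `σ²(Γ₀; k)`: the maximum of `σ²(Γ₀; s)` over the sets `s` of `k` indices that attain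
`μ(Γ₀; k)`. -/
def quantVar {I : ℕ} {n : Fin I → ℕ} (q : Scores n) (Γ₀ : Bias) (k : ℕ) : ℝ :=
  sSup {v | ∃ s : Finset (Fin I), s.card = k ∧
    vecMean q (boundOn Γ₀ s) = quantMean q Γ₀ k ∧ v = vecVar q (boundOn Γ₀ s)}

/-- `μ_i(∞) - μ_i(Γ₀)`. -/
def meanGap {n : ℕ} (q : Fin n → ℝ) (Γ₀ : Bias) : ℝ :=
  maxMean q infBias - maxMean q Γ₀

/-- `s` consists of the `k` sets of smallest rank, when the sets are ranked by
`μ_i(∞) - μ_i(Γ₀)` and, among equal values of it, a smaller `v_i²(Γ₀)` gets a larger rank.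
Remaining ties may be broken in any way. -/
def IsWorstCaseSubset {I : ℕ} {n : Fin I → ℕ} (q : Scores n) (Γ₀ : Bias) (k : ℕ)
    (s : Finset (Fin I)) : Prop :=
  s.card = k ∧ ∀ i ∈ s, ∀ j ∉ s, meanGap (q i) Γ₀ < meanGap (q j) Γ₀ ∨
    (meanGap (q i) Γ₀ = meanGap (q j) Γ₀ ∧ maxVar (q j) Γ₀ ≤ maxVar (q i) Γ₀)

/-- The `p`-value of the statistic value `t` for the null `Γ*_(k) ≤ Γ₀`: the probability that a
Gaussian variable of mean `μ(Γ₀; k)` and variance `σ²(Γ₀; k)` is at least `t` if `t ≥ μ(Γ₀; k)`,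
and `1` otherwise.  If the variance is zero, the Gaussian law is the point mass at its mean. -/
def quantPValue {I : ℕ} {n : Fin I → ℕ} (q : Scores n) (t : ℝ) (Γ₀ : Bias) (k : ℕ) : ℝ :=
  open Classical in
  if quantMean q Γ₀ k ≤ t then
    (ProbabilityTheory.gaussianReal (quantMean q Γ₀ k) (quantVar q Γ₀ k).toNNReal).real
      (Set.Ici t)
  else 1

/-! ### Matched studies -/

/-- A matched study with `I` matched sets in the randomization-based framework, in which
everything but the treatment assignment is fixed.  `y₁`, `y₀` are the potential outcomes, `score`
is the arbitrary function of the outcome vector that gives the `q_{ij}`, and `prob i j` is the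
probability `p*_{ij}` that the unit `j` is the treated unit of the set `i`. -/
structure MatchedStudy (I : ℕ) where
  n : Fin I → ℕ
  two_le_n : ∀ i, 2 ≤ n i
  y₁ : (i : Fin I) → Fin (n i) → ℝ
  y₀ : (i : Fin I) → Fin (n i) → ℝ
  score : ((i : Fin I) → Fin (n i) → ℝ) → Scores n
  prob : (i : Fin I) → Fin (n i) → ℝ
  prob_nonneg : ∀ i j, 0 ≤ prob i j
  prob_sum : ∀ i, ∑ j, prob i j = 1

namespace MatchedStudy

variable {I : ℕ} (S : MatchedStudy I)

/-- A treatment assignment with exactly one treated unit in each set, given by the treated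
units. -/
abbrev Assignment : Type := (i : Fin I) → Fin (S.n i)

/-- The treatment indicator `z_{ij}`. -/
def treat (a : S.Assignment) (i : Fin I) (j : Fin (S.n i)) : ℕ := if a i = j then 1 else 0

/-- `P(Z = z) = ∏ i, ∏ j, (p*_{ij}) ^ z_{ij}`: the treatments of different sets are
independent. -/
def assignProb (a : S.Assignment) : ℝ := ∏ i, ∏ j, S.prob i j ^ S.treat a i j

/-- The probability of an event under the true treatment assignment mechanism. -/
def P (E : Set S.Assignment) : ℝ :=
  open Classical in ∑ a, if a ∈ E then S.assignProb a else 0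

/-- The observed outcomes. -/
def observed (a : S.Assignment) : (i : Fin I) → Fin (S.n i) → ℝ :=
  fun i j => (S.treat a i j : ℝ) * S.y₁ i j + (1 - (S.treat a i j : ℝ)) * S.y₀ i j

/-- Fisher's null hypothesis of no causal effect. -/
def FisherNull : Prop := ∀ i j, S.y₀ i j = S.y₁ i j

/-- The scores computed from the true control potential outcomes. -/
def q₀ : Scores S.n := S.score S.y₀

/-- The scores computed from the observed outcomes, which Fisher's null imputes for the control
potential outcomes. -/
def qObs (a : S.Assignment) : Scores S.n := S.score (S.observed a)

/-- The test statistic `T = ∑ i, ∑ j, Z_{ij} q_{ij}`, computed from the observed data. -/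
def stat (a : S.Assignment) : ℝ := ∑ i, ∑ j, (S.treat a i j : ℝ) * S.qObs a i j

/-- The vector `Γ*` of the true hidden biases. -/
def trueBias : Fin I → Bias := fun i => ⟨lawBias (S.prob i), one_le_lawBias _ (S.prob_sum i)⟩

/-- `s` consists of `k` sets with the smallest true hidden biases (ties broken in any way). -/
def IsLeastBiased (k : ℕ) (s : Finset (Fin I)) : Prop :=
  s.card = k ∧ ∀ i ∈ s, ∀ j ∉ s, S.trueBias i ≤ S.trueBias j

/-- The modified `p`-value with cutoffs `kLow` and `ΓHigh`, computed from the observed data; it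
is `1` for `k = 0`. -/
def pMod (kLow : ℕ) (ΓHigh : ℝ≥0∞) (a : S.Assignment) (Γ₀ : Bias) (k : ℕ) : ℝ :=
  open Classical in
  if (Γ₀ : ℝ≥0∞) ≤ ΓHigh ∧ kLow ≤ k ∧ 1 ≤ k then quantPValue (S.qObs a) (S.stat a) Γ₀ k else 1

/-- The confidence set for `Γ*_(k)`. -/
def quantileCI (kLow : ℕ) (ΓHigh : ℝ≥0∞) (α : ℝ) (a : S.Assignment) (k : ℕ) : Set Bias :=
  {Γ₀ | α < S.pMod kLow ΓHigh a Γ₀ k}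

/-- The confidence set for `I*(Γ₀)`. -/
def countCI (kLow : ℕ) (ΓHigh : ℝ≥0∞) (α : ℝ) (a : S.Assignment) (Γ₀ : Bias) : Set ℕ :=
  {m | ∃ k ≤ I, α < S.pMod kLow ΓHigh a Γ₀ k ∧ m = I - k}

/-- The confidence set for `Γ*_(k)` viewed as a confidence set for `Γ*`: the bias vectors that lie
in no rejected null set `S_{Γ₀;k}`. -/
def quantileRegion (kLow : ℕ) (ΓHigh : ℝ≥0∞) (α : ℝ) (a : S.Assignment) (k : ℕ) :
    Set (Fin I → Bias) :=
  ⋂ (Γ₀ : Bias) (_ : S.pMod kLow ΓHigh a Γ₀ k ≤ α), (nullSet I Γ₀ k)ᶜ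

/-- The confidence set for `I*(Γ₀)` viewed as a confidence set for `Γ*`: the bias vectors that lie
in no rejected null set `S_{Γ₀;k}`. -/
def countRegion (kLow : ℕ) (ΓHigh : ℝ≥0∞) (α : ℝ) (a : S.Assignment) (Γ₀ : Bias) :
    Set (Fin I → Bias) :=
  ⋂ (k ∈ Finset.Icc 1 I) (_ : S.pMod kLow ΓHigh a Γ₀ k ≤ α), (nullSet I Γ₀ k)ᶜ

/-- The joint confidence set for `Γ*`. -/
def jointRegion (kLow : ℕ) (ΓHigh : ℝ≥0∞) (α : ℝ) (a : S.Assignment) : Set (Fin I → Bias) :=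
  ⋂ (x : Bias × ℕ) (_ : x.2 ∈ Finset.Icc 1 I ∧ S.pMod kLow ΓHigh a x.1 x.2 ≤ α),
    (nullSet I x.1 x.2)ᶜ

/-! ### The quantities in the regularity condition -/

/-- `R_i²`. -/
def rangeSq (i : Fin I) : ℝ≥0∞ := ENNReal.ofReal (scoreRange (S.q₀ i) ^ 2)

/-- `∑_{i ∈ s} R_i² / (n_i Γ_i)³`; a set with infinite `Γ_i` contributes zero. -/
def scaledRangeSum (Γ : Fin I → Bias) (s : Finset (Fin I)) : ℝ≥0∞ :=
  ∑ i ∈ s, S.rangeSq i / ((S.n i : ℝ≥0∞) * (Γ i : ℝ≥0∞)) ^ 3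

/-- `A_Γ`: the sets whose true variance exceeds `v_i²(Γ_i)`. -/
def varExcess (Γ : Fin I → Bias) : Finset (Fin I) :=
  open Classical in
  Finset.univ.filter (fun i => maxVar (S.q₀ i) (Γ i) < lawVar (S.prob i) (S.q₀ i))

/-- `Δ_μ(Γ)`. -/
def vecMeanDiff (Γ : Fin I → Bias) : ℝ :=
  (∑ i ∈ S.varExcess Γ, (maxMean (S.q₀ i) (Γ i) - lawMean (S.prob i) (S.q₀ i))) /
    (S.varExcess Γ).card

/-- `Δ_{v²}(Γ)`. -/
def vecVarDiff (Γ : Fin I → Bias) : ℝ :=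
  (∑ i ∈ S.varExcess Γ, (lawVar (S.prob i) (S.q₀ i) - maxVar (S.q₀ i) (Γ i))) /
    (S.varExcess Γ).card

/-- `Δ_μ(Γ) / Δ_{v²}(Γ) * √(∑ i, R_i² / (n_i Γ*_i)³)`, which is `∞` if `A_Γ` is empty. -/
def vecRegularity (Γ : Fin I → Bias) : ℝ≥0∞ :=
  open Classical in
  if S.varExcess Γ = ∅ then ⊤
  else ENNReal.ofReal (S.vecMeanDiff Γ / S.vecVarDiff Γ) *
    S.scaledRangeSum S.trueBias Finset.univ ^ (1 / 2 : ℝ)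

/-- `B_k(Γ₀)`, where `s` is the set of the `k` smallest ranks and `sStar` the set of the `k`
smallest true biases. -/
def swapPairs (Γ₀ : Bias) (s sStar : Finset (Fin I)) : Finset (Fin I × Fin I) :=
  open Classical in
  ((s \ sStar) ×ˢ (sStar \ s)).filter
    (fun x => maxVar (S.q₀ x.1) Γ₀ < maxVar (S.q₀ x.2) Γ₀)

/-- `Δ_μ(Γ₀; k)`. -/
def quantMeanDiff (Γ₀ : Bias) (s sStar : Finset (Fin I)) : ℝ :=
  (∑ x ∈ S.swapPairs Γ₀ s sStar, (meanGap (S.q₀ x.2) Γ₀ - meanGap (S.q₀ x.1) Γ₀)) /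
    (S.swapPairs Γ₀ s sStar).card

/-- `Δ_{v²}(Γ₀; k)`. -/
def quantVarDiff (Γ₀ : Bias) (s sStar : Finset (Fin I)) : ℝ :=
  (∑ x ∈ S.swapPairs Γ₀ s sStar, (maxVar (S.q₀ x.2) Γ₀ - maxVar (S.q₀ x.1) Γ₀)) /
    (S.swapPairs Γ₀ s sStar).card

/-- `Δ_μ(Γ₀; k) / Δ_{v²}(Γ₀; k) * √(∑_{i ∈ sStar} R_i² / (n_i Γ₀)³)`, which is `∞` if `B_k(Γ₀)` is
empty. -/
def quantRegularity (Γ₀ : Bias) (s sStar : Finset (Fin I)) : ℝ≥0∞ :=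
  open Classical in
  if S.swapPairs Γ₀ s sStar = ∅ then ⊤
  else ENNReal.ofReal (S.quantMeanDiff Γ₀ s sStar / S.quantVarDiff Γ₀ s sStar) *
    S.scaledRangeSum (fun _ => Γ₀) sStar ^ (1 / 2 : ℝ)

/-- The pairs `(k, Γ₀)` with `kLow ≤ k ≤ I` and `Γ₀ ∈ [Γ*_(k), ΓHigh]`. -/
def InRange (kLow : ℕ) (ΓHigh : ℝ≥0∞) (k : ℕ) (Γ₀ : Bias) : Prop :=
  1 ≤ k ∧ kLow ≤ k ∧ k ≤ I ∧ orderStat S.trueBias k ≤ Γ₀ ∧ (Γ₀ : ℝ≥0∞) ≤ ΓHigh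

end MatchedStudy

/-- The uniform regularity condition on a sequence of matched studies with `I → ∞` sets.
`leastBiased I k` is the set of the `k` sets with the smallest true biases and `worst I Γ₀ k` that
of the `k` sets with the smallest ranks. -/
structure UniformRegularity (S : (I : ℕ) → MatchedStudy I) (kLow : ℕ → ℕ) (ΓHigh : ℕ → ℝ≥0∞)
    (leastBiased : (I : ℕ) → ℕ → Finset (Fin I))
    (worst : (I : ℕ) → Bias → ℕ → Finset (Fin I)) : Prop where
  clt : Tendsto (fun I => (⨆ i, (S I).rangeSq i) /
      (S I).scaledRangeSum (S I).trueBias Finset.univ) atTop (𝓝 0)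
  vec : Tendsto (fun I => ⨅ (k : ℕ) (Γ₀ : Bias) (_ : (S I).InRange (kLow I) (ΓHigh I) k Γ₀),
      (S I).vecRegularity (boundOn Γ₀ (leastBiased I k))) atTop (𝓝 ⊤)
  quant : Tendsto (fun I => ⨅ (k : ℕ) (Γ₀ : Bias) (_ : (S I).InRange (kLow I) (ΓHigh I) k Γ₀),
      (S I).quantRegularity Γ₀ (worst I Γ₀ k) (leastBiased I k)) atTop (𝓝 ⊤)

end

/-! ### Order statistics and exceedance counts -/

/-! The set identities only reorder the same intersections. A vector in no rejected null set is
tested at `Γ₀ := orderStat Γ k`, respectively at the `k` that counts its coordinates `≤ Γ₀`.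
Monotonicity of the `p`-value carries non-rejection from there to every other null containing the
vector.

Coverage needs no multiplicity correction, because all false rejections lie in one event. Let `z ≥
0` be the least point with standard Gaussian tail at most `α`. Rejecting at `(Γ₀, k)` forces `T ≥
μ(Γ₀;k) + z σ(Γ₀;k)`. For large `I`, simultaneously for all true nulls within the cutoffs, this
threshold is at least the true mean of `T` plus `z` true standard deviations
(`trueMean_add_le_quantMean_add`). So a false rejection implies that the standardized `T` is at
least `z`, and the central limit theorem bounds the limsup of this probability by `α`.

The comparison of thresholds has two steps: from the true moments to the bounds on the least biased
sets (`trueMean_add_le_vecMean_add`), then to the worst-case sets (`vecMean_add_le_vecMean_add`). In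
each, the mean does not decrease, but the variance may. Conditions (ii) and (iii) say that the gain
in mean outweighs `z` times the loss in standard deviation, since the sums of `R_i²/(n_i Γ_i)³` in
them are lower bounds for variances.

The central limit theorem is proved with characteristic functions: (i) makes the standardized scores
uniformly small, so the product of the characteristic functions of the sets is close to the Gaussian
one (`norm_prod_lawChar_sub_gaussian_le`). -/

theorem orderStat_le_iff {I : ℕ} (Γ : Fin I → Bias) (Γ₀ : Bias) {k : ℕ} (h1 : 1 ≤ k)
    (hk : k ≤ I) : orderStat Γ k ≤ Γ₀ ↔ k ≤ (Finset.univ.filter fun i => Γ i ≤ Γ₀).card := by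
  have hcard : (Finset.univ.filter fun i => (Γ ∘ Tuple.sort Γ) i ≤ Γ₀).card =
      (Finset.univ.filter fun i => Γ i ≤ Γ₀).card := by
    refine Finset.card_bij (fun i _ => Tuple.sort Γ i) (by simp) (by simp) fun b hb => ?_
    exact ⟨(Tuple.sort Γ).symm b, by simpa using hb, by simp⟩
  -- In the sorted vector the entries `≤ Γ₀` form an initial segment. The zero-based position `k -
  -- 1` lies in it iff `k - 1` is less than the count, that is, iff `k` is at most the count.
  have := Tuple.lt_card_le_iff_apply_le_of_monotone (a := Γ₀) (j := (⟨k - 1, by omega⟩ : Fin I))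
    (Tuple.monotone_sort Γ)
  rw [hcard] at this
  rw [orderStat, dif_pos ⟨h1, hk⟩]
  refine this.symm.trans ?_
  simp only
  omega

theorem card_le_add_exceedCount {I : ℕ} (Γ : Fin I → Bias) (Γ₀ : Bias) :
    (Finset.univ.filter fun i => Γ i ≤ Γ₀).card + exceedCount Γ Γ₀ = I := by
  simpa [exceedCount] using
    Finset.card_filter_add_card_filter_not (s := Finset.univ) (fun i => Γ i ≤ Γ₀)

/-! ### Confidence regions, and the least biased sets under a true null. -/

namespace MatchedStudy

variable {I : ℕ} (S : MatchedStudy I) {kLow : ℕ} {ΓHigh : ℝ≥0∞} {α : ℝ} {a : S.Assignment}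

theorem mem_quantileRegion {k : ℕ} {Γ : Fin I → Bias} :
    Γ ∈ S.quantileRegion kLow ΓHigh α a k ↔
      ∀ Γ₀, S.pMod kLow ΓHigh a Γ₀ k ≤ α → ¬ orderStat Γ k ≤ Γ₀ := by
  simp [quantileRegion, nullSet]

theorem mem_countRegion {Γ₀ : Bias} {Γ : Fin I → Bias} :
    Γ ∈ S.countRegion kLow ΓHigh α a Γ₀ ↔
      ∀ k, 1 ≤ k → k ≤ I → S.pMod kLow ΓHigh a Γ₀ k ≤ α → ¬ orderStat Γ k ≤ Γ₀ := by
  simp [countRegion, nullSet]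

theorem mem_jointRegion {Γ : Fin I → Bias} :
    Γ ∈ S.jointRegion kLow ΓHigh α a ↔ ∀ k, 1 ≤ k → k ≤ I → ∀ Γ₀,
      S.pMod kLow ΓHigh a Γ₀ k ≤ α → ¬ orderStat Γ k ≤ Γ₀ := by
  simp only [jointRegion, nullSet, Set.mem_iInter, Prod.forall, Finset.mem_Icc, Set.mem_compl_iff,
    Set.mem_ofPred_eq]
  exact ⟨fun h k h1 h2 Γ₀ h3 => h Γ₀ k ⟨⟨h1, h2⟩, h3⟩, fun h Γ₀ k h' => h k h'.1.1 h'.1.2 Γ₀ h'.2⟩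

theorem iInter_quantileRegion_eq_jointRegion :
    (⋂ k ∈ Finset.Icc 1 I, S.quantileRegion kLow ΓHigh α a k) =
      S.jointRegion kLow ΓHigh α a := by
  ext Γ
  simp only [Set.mem_iInter, mem_quantileRegion, mem_jointRegion, Finset.mem_Icc, and_imp]

theorem iInter_countRegion_eq_jointRegion :
    (⋂ Γ₀ : Bias, S.countRegion kLow ΓHigh α a Γ₀) = S.jointRegion kLow ΓHigh α a := by
  ext Γ
  simp only [Set.mem_iInter, mem_countRegion, mem_jointRegion]
  exact ⟨fun h k h1 h2 Γ₀ => h Γ₀ k h1 h2, fun h Γ₀ k h1 h2 => h k h1 h2 Γ₀⟩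

theorem quantileRegion_subset (k : ℕ) :
    S.quantileRegion kLow ΓHigh α a k ⊆
      {Γ | orderStat Γ k ∈ S.quantileCI kLow ΓHigh α a k} := by
  intro Γ h
  rw [mem_quantileRegion] at h
  by_contra hn
  exact h (orderStat Γ k) (not_lt.1 hn) le_rfl

theorem quantileRegion_eq_of_monotone {k : ℕ}
    (hmono : Monotone fun Γ₀ => S.pMod kLow ΓHigh a Γ₀ k) :
    S.quantileRegion kLow ΓHigh α a k =
      {Γ | orderStat Γ k ∈ S.quantileCI kLow ΓHigh α a k} := by
  refine (S.quantileRegion_subset k).antisymm fun Γ h => ?_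
  rw [mem_quantileRegion]
  intro Γ₀ hp hle
  exact absurd (lt_of_lt_of_le h (hmono hle)) (not_lt.2 hp)

theorem countRegion_subset (hα : α < 1) (Γ₀ : Bias) :
    S.countRegion kLow ΓHigh α a Γ₀ ⊆
      {Γ | exceedCount Γ Γ₀ ∈ S.countCI kLow ΓHigh α a Γ₀} := by
  intro Γ h
  rw [mem_countRegion] at h
  have hc := card_le_add_exceedCount Γ Γ₀
  refine ⟨(Finset.univ.filter fun i => Γ i ≤ Γ₀).card, by omega, ?_, by omega⟩
  -- If every coordinate exceeds `Γ₀`, the witness is `k = 0`, which no null set in the region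
  -- covers; there the `p`-value is `1` by convention, hence above `α`.
  rcases Nat.eq_zero_or_pos (Finset.univ.filter fun i => Γ i ≤ Γ₀).card with h0 | hpos
  · rw [h0, pMod, if_neg (by omega)]
    exact hα
  · by_contra hn
    exact h _ hpos (by omega) (not_lt.1 hn)
      ((orderStat_le_iff Γ Γ₀ hpos (by omega)).2 le_rfl)

theorem countRegion_eq_of_antitoneOn (hα : α < 1) {Γ₀ : Bias}
    (hanti : AntitoneOn (fun k => S.pMod kLow ΓHigh a Γ₀ k) (Set.Iic I)) :
    S.countRegion kLow ΓHigh α a Γ₀ =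
      {Γ | exceedCount Γ Γ₀ ∈ S.countCI kLow ΓHigh α a Γ₀} := by
  refine (S.countRegion_subset hα Γ₀).antisymm fun Γ h => ?_
  obtain ⟨k, hk, hp, hm⟩ := h
  rw [mem_countRegion]
  intro l h1 hl hpl hle
  rw [orderStat_le_iff Γ Γ₀ h1 hl] at hle
  have hc := card_le_add_exceedCount Γ Γ₀
  -- Since `k ≤ I`, the truncated `I - k` loses nothing: `k` is exactly the number of coordinates `≤
  -- Γ₀`.
  have hlk : l ≤ k := by omega
  exact absurd (hp.trans_le (hanti (Set.mem_Iic.2 hl) (Set.mem_Iic.2 hk) hlk)) (not_lt.2 hpl)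

theorem trueBias_le_of_isLeastBiased {k : ℕ} (h1 : 1 ≤ k) (hk : k ≤ I) {s : Finset (Fin I)}
    (hs : S.IsLeastBiased k s) {Γ₀ : Bias} (hΓ : orderStat S.trueBias k ≤ Γ₀) {i : Fin I}
    (hi : i ∈ s) : S.trueBias i ≤ Γ₀ := by
  rw [orderStat_le_iff _ _ h1 hk] at hΓ
  by_contra hlt
  -- If `i ∈ s` had bias above `Γ₀`, so would everything outside `s`; at most `k - 1` biases would
  -- then be `≤ Γ₀`.
  have hsub : (Finset.univ.filter fun i => S.trueBias i ≤ Γ₀) ⊆ s.erase i := by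
    intro j hj
    have hj' : S.trueBias j ≤ Γ₀ := by simpa using hj
    refine Finset.mem_erase.2 ⟨fun h => hlt (h ▸ hj'), ?_⟩
    by_contra hjs
    exact hlt ((hs.2 i hi j hjs).trans hj')
  have h2 := Finset.card_le_card hsub
  rw [Finset.card_erase_of_mem hi, hs.1] at h2
  omega

end MatchedStudy

/-! ### Mean and variance of a score in one matched set -/

theorem le_ciSup_fin {n : ℕ} (q : Fin n → ℝ) (j : Fin n) : q j ≤ ⨆ l, q l :=
  le_ciSup (Set.finite_range q).bddAbove j

theorem ciInf_fin_le {n : ℕ} (q : Fin n → ℝ) (j : Fin n) : ⨅ l, q l ≤ q j :=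
  ciInf_le (Set.finite_range q).bddBelow j

theorem stdSimplex_nonempty_index {n : ℕ} {p : Fin n → ℝ} (hp : p ∈ stdSimplex ℝ (Fin n)) :
    Nonempty (Fin n) := by
  by_contra h
  rw [not_nonempty_iff] at h
  simpa using hp.2

theorem lawMean_le_ciSup {n : ℕ} {p : Fin n → ℝ} (hp : p ∈ stdSimplex ℝ (Fin n))
    (q : Fin n → ℝ) : lawMean p q ≤ ⨆ j, q j := by
  calc lawMean p q ≤ ∑ j, p j * ⨆ l, q l :=
        Finset.sum_le_sum fun j _ => mul_le_mul_of_nonneg_left (le_ciSup_fin q j) (hp.1 j)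
    _ = ⨆ j, q j := by rw [← Finset.sum_mul, hp.2, one_mul]

theorem ciInf_le_lawMean {n : ℕ} {p : Fin n → ℝ} (hp : p ∈ stdSimplex ℝ (Fin n))
    (q : Fin n → ℝ) : ⨅ j, q j ≤ lawMean p q := by
  calc ⨅ j, q j = ∑ j, p j * ⨅ l, q l := by rw [← Finset.sum_mul, hp.2, one_mul]
    _ ≤ lawMean p q :=
        Finset.sum_le_sum fun j _ => mul_le_mul_of_nonneg_left (ciInf_fin_le q j) (hp.1 j)

theorem abs_sub_lawMean_le {n : ℕ} {p : Fin n → ℝ} (hp : p ∈ stdSimplex ℝ (Fin n))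
    (q : Fin n → ℝ) (j : Fin n) : |q j - lawMean p q| ≤ scoreRange q := by
  have h1 := lawMean_le_ciSup hp q
  have h2 := ciInf_le_lawMean hp q
  have h3 := le_ciSup_fin q j
  have h4 := ciInf_fin_le q j
  rw [scoreRange, abs_le]
  constructor <;> linarith

theorem lawVar_nonneg {n : ℕ} {p : Fin n → ℝ} (hp : p ∈ stdSimplex ℝ (Fin n))
    (q : Fin n → ℝ) : 0 ≤ lawVar p q :=
  Finset.sum_nonneg fun j _ => mul_nonneg (hp.1 j) (sq_nonneg _)

theorem lawVar_le_sq_scoreRange {n : ℕ} {p : Fin n → ℝ} (hp : p ∈ stdSimplex ℝ (Fin n))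
    (q : Fin n → ℝ) : lawVar p q ≤ scoreRange q ^ 2 := by
  calc lawVar p q ≤ ∑ j, p j * scoreRange q ^ 2 :=
        Finset.sum_le_sum fun j _ => mul_le_mul_of_nonneg_left
          (sq_le_sq' (abs_le.1 (abs_sub_lawMean_le hp q j)).1
            (abs_le.1 (abs_sub_lawMean_le hp q j)).2) (hp.1 j)
    _ = scoreRange q ^ 2 := by rw [← Finset.sum_mul, hp.2, one_mul]

theorem lawMean_le_maxMean {n : ℕ} {Γ : Bias} {p : Fin n → ℝ} (hp : p ∈ sensitivityLaws n Γ)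
    (q : Fin n → ℝ) : lawMean p q ≤ maxMean q Γ :=
  le_csSup ⟨⨆ j, q j, by rintro _ ⟨p, hp, rfl⟩; exact lawMean_le_ciSup hp.1 q⟩ ⟨p, hp, rfl⟩

theorem lawVar_le_maxVar {n : ℕ} {Γ : Bias} {p q : Fin n → ℝ} (hp : p ∈ sensitivityLaws n Γ)
    (hmax : lawMean p q = maxMean q Γ) : lawVar p q ≤ maxVar q Γ :=
  le_csSup ⟨scoreRange q ^ 2, by rintro _ ⟨p, hp, -, rfl⟩; exact lawVar_le_sq_scoreRange hp.1 q⟩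
    ⟨p, hp, hmax, rfl⟩

theorem maxVar_nonneg {n : ℕ} (q : Fin n → ℝ) (Γ : Bias) : 0 ≤ maxVar q Γ :=
  Real.sSup_nonneg (by rintro _ ⟨p, hp, -, rfl⟩; exact lawVar_nonneg hp.1 q)

theorem maxVar_le_sq_scoreRange {n : ℕ} (q : Fin n → ℝ) (Γ : Bias) :
    maxVar q Γ ≤ scoreRange q ^ 2 :=
  Real.sSup_le (by rintro _ ⟨p, hp, -, rfl⟩; exact lawVar_le_sq_scoreRange hp.1 q) (sq_nonneg _)

theorem mem_sensitivityLaws_infBias {n : ℕ} {p : Fin n → ℝ} :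
    p ∈ sensitivityLaws n infBias ↔ p ∈ stdSimplex ℝ (Fin n) :=
  ⟨fun h => h.1, fun h => ⟨h, fun h' => absurd rfl h'⟩⟩

/-- Without a constraint, a law maximizing the mean is supported where the score is maximal, so the
score is almost surely constant. -/
theorem maxVar_infBias {n : ℕ} (q : Fin n → ℝ) : maxVar q infBias = 0 := by
  refine le_antisymm (Real.sSup_le ?_ le_rfl) (maxVar_nonneg _ _)
  rintro _ ⟨p, hp, hmax, rfl⟩
  have hle : ∀ j, q j ≤ maxMean q infBias := fun j => by
    have h := lawMean_le_maxMean
      (mem_sensitivityLaws_infBias.2 (single_mem_stdSimplex ℝ j)) q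
    simpa [lawMean, Pi.single_apply] using h
  have hzero : ∑ j, p j * (maxMean q infBias - q j) = 0 := by
    simp only [mul_sub, Finset.sum_sub_distrib, ← Finset.sum_mul, hp.1.2, one_mul]
    exact sub_eq_zero.2 hmax.symm
  rw [Finset.sum_eq_zero_iff_of_nonneg
    fun j _ => mul_nonneg (hp.1.1 j) (sub_nonneg.2 (hle j))] at hzero
  refine (Finset.sum_eq_zero fun j hj => ?_).le
  have h1 := hzero j hj
  rw [hmax, show p j * (q j - maxMean q infBias) ^ 2 =
    (p j * (maxMean q infBias - q j)) * (maxMean q infBias - q j) by ring, h1, zero_mul]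

theorem one_le_toReal {Γ : Bias} (hΓ : (Γ : ℝ≥0∞) ≠ ⊤) : 1 ≤ (Γ : ℝ≥0∞).toReal := by
  have := ENNReal.toReal_mono hΓ (Set.mem_Ici.1 Γ.2)
  simpa using this

theorem inv_le_of_mem_sensitivityLaws {n : ℕ} {Γ : Bias} (hΓ : (Γ : ℝ≥0∞) ≠ ⊤) {p : Fin n → ℝ}
    (hp : p ∈ sensitivityLaws n Γ) (j : Fin n) : 1 / (n * (Γ : ℝ≥0∞).toReal) ≤ p j := by
  obtain ⟨u, hu, hpu⟩ := hp.2 hΓ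
  have hg := one_le_toReal hΓ
  have hlog : 0 ≤ Real.log (Γ : ℝ≥0∞).toReal := Real.log_nonneg hg
  have hsum : ∑ l, Real.exp (Real.log (Γ : ℝ≥0∞).toReal * u l) ≤ n * (Γ : ℝ≥0∞).toReal := by
    calc _ ≤ ∑ _l : Fin n, (Γ : ℝ≥0∞).toReal := Finset.sum_le_sum fun l _ => by
          calc Real.exp (Real.log (Γ : ℝ≥0∞).toReal * u l)
              ≤ Real.exp (Real.log (Γ : ℝ≥0∞).toReal) :=
                Real.exp_le_exp.2 (mul_le_of_le_one_right hlog (hu l).2)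
            _ = _ := Real.exp_log (by linarith)
      _ = _ := by simp
  have hpos : 0 < ∑ l, Real.exp (Real.log (Γ : ℝ≥0∞).toReal * u l) :=
    Finset.sum_pos (fun l _ => Real.exp_pos _) ⟨j, Finset.mem_univ j⟩
  rw [hpu j]
  exact div_le_div₀ (Real.exp_pos _).le
    (Real.one_le_exp (mul_nonneg hlog (hu j).1)) hpos hsum

/-- The laws are the continuous image of the cube `[0,1]^n`, hence compact. Without an attained
maximum, `maxVar` could be the supremum of an empty set. -/
theorem exists_sensitivityLaws_maximizer {n : ℕ} (hn : 0 < n) (Γ : Bias)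
    (hΓ : (Γ : ℝ≥0∞) ≠ ⊤) (q : Fin n → ℝ) :
    ∃ p ∈ sensitivityLaws n Γ, lawMean p q = maxMean q Γ := by
  have : Nonempty (Fin n) := ⟨⟨0, hn⟩⟩
  set g := Real.log (Γ : ℝ≥0∞).toReal
  let f : (Fin n → ℝ) → Fin n → ℝ :=
    fun u j => Real.exp (g * u j) / ∑ l, Real.exp (g * u l)
  have hne : ∀ u : Fin n → ℝ, 0 < ∑ l, Real.exp (g * u l) := fun u =>
    Finset.sum_pos (fun l _ => Real.exp_pos _) Finset.univ_nonempty
  have hf : Continuous f := continuous_pi fun j =>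
    Continuous.div (by fun_prop) (by fun_prop) fun u => (hne u).ne'
  have heq : sensitivityLaws n Γ = f '' Set.univ.pi fun _ => Set.Icc (0 : ℝ) 1 := by
    ext p
    constructor
    · intro hp
      obtain ⟨u, hu, hpu⟩ := hp.2 hΓ
      exact ⟨u, fun j _ => hu j, (funext hpu).symm⟩
    · rintro ⟨u, hu, rfl⟩
      refine ⟨⟨fun j => div_nonneg (Real.exp_pos _).le (hne u).le, ?_⟩,
        fun _ => ⟨u, fun j => hu j trivial, fun j => rfl⟩⟩
      simp only [f, ← Finset.sum_div]
      exact div_self (hne u).ne'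
  have hcomp : IsCompact (sensitivityLaws n Γ) :=
    heq ▸ (isCompact_univ_pi fun _ => isCompact_Icc).image hf
  have hnon : (sensitivityLaws n Γ).Nonempty := by
    rw [heq]
    exact ⟨f 0, 0, fun _ _ => by simp, rfl⟩
  have hcont : Continuous fun p : Fin n → ℝ => lawMean p q := by
    unfold lawMean
    fun_prop
  obtain ⟨p, hp, hmax⟩ := hcomp.exists_isMaxOn hnon hcont.continuousOn
  refine ⟨p, hp, le_antisymm (lawMean_le_maxMean hp q) (csSup_le ⟨_, p, hp, rfl⟩ ?_)⟩
  rintro _ ⟨p', hp', rfl⟩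
  exact hmax hp'

/-- Keep only the terms of a largest and a smallest score: two squared distances to a common point
sum to at least half the squared distance between the scores. -/
theorem lawVar_ge_of_le {n : ℕ} {p : Fin n → ℝ} (hp : p ∈ stdSimplex ℝ (Fin n))
    {c : ℝ} (hc : 0 ≤ c) (hcp : ∀ j, c ≤ p j) (q : Fin n → ℝ) :
    c * scoreRange q ^ 2 / 2 ≤ lawVar p q := by
  have := stdSimplex_nonempty_index hp
  obtain ⟨a, ha⟩ := exists_eq_ciSup_of_finite (f := q)
  obtain ⟨b, hb⟩ := exists_eq_ciInf_of_finite (f := q)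
  rcases eq_or_ne a b with rfl | hab
  · rw [scoreRange, ← ha, ← hb]
    simpa using lawVar_nonneg hp q
  have hsub : ∑ j ∈ {a, b}, p j * (q j - lawMean p q) ^ 2 ≤ lawVar p q :=
    Finset.sum_le_sum_of_subset_of_nonneg (Finset.subset_univ _)
      fun j _ _ => mul_nonneg (hp.1 j) (sq_nonneg _)
  rw [Finset.sum_pair hab] at hsub
  have h1 := mul_le_mul_of_nonneg_right (hcp a) (sq_nonneg (q a - lawMean p q))
  have h2 := mul_le_mul_of_nonneg_right (hcp b) (sq_nonneg (q b - lawMean p q))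
  have h3 : 0 ≤ c * (q a + q b - 2 * lawMean p q) ^ 2 := mul_nonneg hc (sq_nonneg _)
  rw [scoreRange, ← ha, ← hb]
  nlinarith

/-- Each probability is at least `1/(nΓ)`, so the variance is at least `R²/(2nΓ)`. The cube is
cruder: `nΓ ≥ 2` gives `2nΓ ≤ (nΓ)³`. -/
theorem ofReal_sq_scoreRange_div_le {n : ℕ} (hn : 2 ≤ n) {Γ : Bias} {p : Fin n → ℝ}
    (hΓ : (Γ : ℝ≥0∞) ≠ ⊤) (hp : p ∈ sensitivityLaws n Γ) (q : Fin n → ℝ) :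
    ENNReal.ofReal (scoreRange q ^ 2) / ((n : ℝ≥0∞) * (Γ : ℝ≥0∞)) ^ 3 ≤
      ENNReal.ofReal (lawVar p q) := by
  have hg := one_le_toReal hΓ
  set g := (Γ : ℝ≥0∞).toReal with hgdef
  have hn' : (2 : ℝ) ≤ n := by exact_mod_cast hn
  have hng : 2 ≤ n * g := by nlinarith
  have hΓg : (Γ : ℝ≥0∞) = ENNReal.ofReal g := (ENNReal.ofReal_toReal hΓ).symm
  rw [hΓg, ← ENNReal.ofReal_natCast, ← ENNReal.ofReal_mul (by positivity),
    ← ENNReal.ofReal_pow (by positivity), ← ENNReal.ofReal_div_of_pos (by positivity)]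
  refine ENNReal.ofReal_le_ofReal (le_trans ?_ (lawVar_ge_of_le hp.1 (by positivity)
    (inv_le_of_mem_sensitivityLaws hΓ hp) q))
  rw [one_div_mul_eq_div, div_div]
  refine div_le_div_of_nonneg_left (sq_nonneg _) (by positivity) ?_
  nlinarith [mul_nonneg (sub_nonneg.2 hng) (sub_nonneg.2 hng)]

theorem mem_sensitivityLaws_of_lawBias_le {n : ℕ} {p : Fin n → ℝ}
    (hp : p ∈ stdSimplex ℝ (Fin n)) {Γ : Bias} (h : lawBias p ≤ Γ) :
    p ∈ sensitivityLaws n Γ := by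
  refine ⟨hp, fun hΓ => ?_⟩
  have hg := one_le_toReal hΓ
  set g := (Γ : ℝ≥0∞).toReal with hgdef
  have hΓg : (Γ : ℝ≥0∞) = ENNReal.ofReal g := (ENNReal.ofReal_toReal hΓ).symm
  have := stdSimplex_nonempty_index hp
  obtain ⟨b, hb⟩ := exists_eq_ciInf_of_finite (f := fun j => ENNReal.ofReal (p j))
  have hle : ∀ j, ENNReal.ofReal (p j) / ENNReal.ofReal (p b) ≤ ENNReal.ofReal g := fun j => by
    rw [← hΓg, hb]
    exact (ENNReal.div_le_div_right (le_iSup (fun j => ENNReal.ofReal (p j)) j) _).trans h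
  have hbj : ∀ j, p b ≤ p j := fun j => by
    have h1 : ENNReal.ofReal (p b) ≤ ENNReal.ofReal (p j) := by
      rw [hb]
      exact iInf_le (fun j => ENNReal.ofReal (p j)) j
    exact (ENNReal.ofReal_le_ofReal_iff (hp.1 j)).1 h1
  -- A zero minimum makes every ratio with a positive numerator infinite; a finite bias would force
  -- all probabilities to vanish.
  have hpb : 0 < p b := by
    refine (hp.1 b).lt_of_ne fun h0 => ?_
    have hall : ∀ j, p j = 0 := fun j => by
      by_contra hj
      have h2 := hle j
      rw [← h0, ENNReal.ofReal_zero, ENNReal.div_zero] at h2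
      · exact absurd h2 (by simp)
      · exact (ENNReal.ofReal_pos.2 ((hp.1 j).lt_of_ne' hj)).ne'
    simpa [hall] using hp.2
  have hratio : ∀ j, p j / p b ≤ g := fun j => by
    have := hle j
    rw [← ENNReal.ofReal_div_of_pos hpb] at this
    exact (ENNReal.ofReal_le_ofReal_iff (by linarith)).1 this
  have hone : ∀ j, 1 ≤ p j / p b := fun j => (one_le_div hpb).2 (hbj j)
  have hlog : ∀ j, Real.log (p j / p b) ≤ Real.log g := fun j =>
    Real.log_le_log (by linarith [hone j]) (hratio j)
  have hlog0 : ∀ j, 0 ≤ Real.log (p j / p b) := fun j => Real.log_nonneg (hone j)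
  -- The confounder is the log ratio to the smallest probability, rescaled by `log g`. If `g = 1`,
  -- the division by zero is harmless because all log ratios vanish.
  have hexp : ∀ j, Real.exp (Real.log g * (Real.log (p j / p b) / Real.log g)) = p j / p b := by
    intro j
    rw [mul_div_cancel_of_imp' fun h0 => le_antisymm (h0 ▸ hlog j) (hlog0 j),
      Real.exp_log (by linarith [hone j])]
  refine ⟨fun j => Real.log (p j / p b) / Real.log g,
    fun j => ⟨div_nonneg (hlog0 j) (Real.log_nonneg hg), div_le_one_of_le₀ (hlog j)
      (Real.log_nonneg hg)⟩, fun j => ?_⟩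
  simp only [hexp, ← Finset.sum_div, hp.2]
  field_simp

/-! ### Comparison of Gaussian quantiles with different means and variances -/

/-- When the variance drops, `√v₁ (√v₁ - √v₂) ≤ v₁ - v₂`, so a bound on the difference of variances
controls the difference of standard deviations. -/
theorem add_mul_sqrt_le_add_mul_sqrt {z m₁ m₂ v₁ v₂ : ℝ} (hz : 0 ≤ z) (hv₁ : 0 ≤ v₁)
    (hv₂ : 0 ≤ v₂) (hm : m₁ ≤ m₂) (h : z * (v₁ - v₂) ≤ √v₁ * (m₂ - m₁)) :
    m₁ + z * √v₁ ≤ m₂ + z * √v₂ := by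
  rcases le_or_gt (√v₁) (√v₂) with hle | hlt
  · have := mul_le_mul_of_nonneg_left hle hz
    linarith
  · have h2 := Real.sqrt_nonneg v₂
    have hpos : 0 < √v₁ := h2.trans_lt hlt
    have h3 : √v₁ * (z * (√v₁ - √v₂)) ≤ √v₁ * (m₂ - m₁) := by
      refine le_trans ?_ h
      rw [← Real.sq_sqrt hv₁, ← Real.sq_sqrt hv₂, Real.sqrt_sq hpos.le, Real.sqrt_sq h2]
      have : 0 ≤ z * ((√v₁ - √v₂) * √v₂) :=
        mul_nonneg hz (mul_nonneg (sub_nonneg.2 hlt.le) h2)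
      nlinarith
    have := le_of_mul_le_mul_left h3 hpos
    linarith

/-- Turns a regularity condition in `ℝ≥0∞` into a real inequality: `c` is the number of terms in
both averages and cancels, and `W` is a lower bound for the variance `V`. -/
theorem mul_le_mul_sqrt_of_ofReal_le {z A B c V : ℝ} {W : ℝ≥0∞} (hA : 0 ≤ A) (hB : 0 < B)
    (hc : c ≠ 0) (hV : 0 ≤ V) (hW : W ≤ ENNReal.ofReal V)
    (h : ENNReal.ofReal z ≤ ENNReal.ofReal (A / c / (B / c)) * W ^ (1 / 2 : ℝ)) :
    z * B ≤ A * √V := by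
  have h1 : ENNReal.ofReal z ≤ ENNReal.ofReal (A / B * √V) := by
    refine h.trans ?_
    rw [div_div_div_cancel_right₀ hc, ENNReal.ofReal_mul (div_nonneg hA hB.le),
      Real.sqrt_eq_rpow, ← ENNReal.ofReal_rpow_of_nonneg hV (by norm_num)]
    gcongr
  have h2 := (ENNReal.ofReal_le_ofReal_iff
    (mul_nonneg (div_nonneg hA hB.le) (Real.sqrt_nonneg V))).1 h1
  rw [div_mul_eq_mul_div, le_div_iff₀ hB] at h2
  exact h2

/-- Relates sums over the swap pairs to differences of bounds: each index of `t \ s` or `s \ t`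
occurs in `(s \ t).card` pairs, and the common part of `s` and `t` cancels. -/
theorem sum_product_sdiff_sub {ι : Type*} [DecidableEq ι] (f : ι → ℝ) {s t : Finset ι}
    (h : s.card = t.card) :
    ∑ x ∈ (s \ t) ×ˢ (t \ s), (f x.2 - f x.1) =
      (s \ t).card * (∑ i ∈ t, f i - ∑ i ∈ s, f i) := by
  rw [Finset.sum_product, ← Finset.sum_sdiff_sub_sum_sdiff]
  simp only [Finset.sum_sub_distrib, Finset.sum_const, nsmul_eq_mul]
  rw [← Finset.mul_sum, Finset.card_sdiff_comm h]
  ring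

theorem eq_of_card_sdiff_eq_zero {ι : Type*} [DecidableEq ι] {s t : Finset ι}
    (h : s.card = t.card) (h0 : (s \ t).card = 0) : s = t :=
  Finset.eq_of_subset_of_card_le (Finset.sdiff_eq_empty_iff_subset.1 (Finset.card_eq_zero.1 h0))
    h.ge

/-! ### Bounds on sets of `k` indices, and the worst-case choice. -/

section Bounds

variable {I : ℕ} {n : Fin I → ℕ} (q : Scores n)

theorem vecMean_boundOn (Γ₀ : Bias) (s : Finset (Fin I)) :
    vecMean q (boundOn Γ₀ s) = ∑ i, maxMean (q i) infBias - ∑ i ∈ s, meanGap (q i) Γ₀ := by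
  have h := Finset.sum_ite_mem Finset.univ s fun i => meanGap (q i) Γ₀
  rw [Finset.univ_inter] at h
  rw [← h, ← Finset.sum_sub_distrib]
  refine Finset.sum_congr rfl fun i _ => ?_
  by_cases hi : i ∈ s <;> simp [boundOn, hi, meanGap]

theorem vecVar_boundOn (Γ₀ : Bias) (s : Finset (Fin I)) :
    vecVar q (boundOn Γ₀ s) = ∑ i ∈ s, maxVar (q i) Γ₀ := by
  have h := Finset.sum_ite_mem Finset.univ s fun i => maxVar (q i) Γ₀
  rw [Finset.univ_inter] at h
  rw [← h]
  refine Finset.sum_congr rfl fun i _ => ?_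
  by_cases hi : i ∈ s <;> simp [boundOn, hi, maxVar_infBias]

theorem vecVar_nonneg (Γ : Fin I → Bias) : 0 ≤ vecVar q Γ :=
  Finset.sum_nonneg fun i _ => maxVar_nonneg (q i) (Γ i)

theorem vecMean_le_quantMean (Γ₀ : Bias) (s : Finset (Fin I)) :
    vecMean q (boundOn Γ₀ s) ≤ quantMean q Γ₀ s.card := by
  refine le_csSup (Set.Finite.bddAbove ?_) ⟨s, rfl, rfl⟩
  refine (Set.finite_range fun s => vecMean q (boundOn Γ₀ s)).subset ?_
  rintro _ ⟨s, -, rfl⟩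
  exact ⟨s, rfl⟩

theorem vecVar_le_quantVar {Γ₀ : Bias} {s : Finset (Fin I)}
    (h : vecMean q (boundOn Γ₀ s) = quantMean q Γ₀ s.card) :
    vecVar q (boundOn Γ₀ s) ≤ quantVar q Γ₀ s.card := by
  refine le_csSup (Set.Finite.bddAbove ?_) ⟨s, rfl, h, rfl⟩
  refine (Set.finite_range fun s => vecVar q (boundOn Γ₀ s)).subset ?_
  rintro _ ⟨s, -, -, rfl⟩
  exact ⟨s, rfl⟩

variable {q} {Γ₀ : Bias} {k : ℕ} {s : Finset (Fin I)}

theorem IsWorstCaseSubset.meanGap_le (hs : IsWorstCaseSubset q Γ₀ k s) {i j : Fin I}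
    (hi : i ∈ s) (hj : j ∉ s) : meanGap (q i) Γ₀ ≤ meanGap (q j) Γ₀ :=
  (hs.2 i hi j hj).elim le_of_lt fun h => h.1.le

theorem IsWorstCaseSubset.vecMean_eq (hs : IsWorstCaseSubset q Γ₀ k s) :
    vecMean q (boundOn Γ₀ s) = quantMean q Γ₀ k := by
  refine le_antisymm (hs.1 ▸ vecMean_le_quantMean q Γ₀ s) (csSup_le ⟨_, s, hs.1, rfl⟩ ?_)
  rintro _ ⟨t, ht, rfl⟩
  rw [vecMean_boundOn, vecMean_boundOn]
  have hcard : s.card = t.card := hs.1.trans ht.symm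
  rcases Nat.eq_zero_or_pos (s \ t).card with h0 | hpos
  · rw [eq_of_card_sdiff_eq_zero hcard h0]
  · have h1 := sum_product_sdiff_sub (fun i => meanGap (q i) Γ₀) hcard
    have h2 : 0 ≤ ∑ x ∈ (s \ t) ×ˢ (t \ s), (meanGap (q x.2) Γ₀ - meanGap (q x.1) Γ₀) :=
      Finset.sum_nonneg fun x hx => by
        rw [Finset.mem_product, Finset.mem_sdiff, Finset.mem_sdiff] at hx
        exact sub_nonneg.2 (hs.meanGap_le hx.1.1 hx.2.2)
    rw [h1] at h2
    have h3 := nonneg_of_mul_nonneg_right h2 (by exact_mod_cast hpos)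
    linarith

end Bounds

/-! ### Comparison of the true moments with the bounds under the regularity condition. -/

namespace MatchedStudy

variable {I : ℕ} (S : MatchedStudy I)

/-- The true mean of the statistic. -/
noncomputable def trueMean : ℝ := ∑ i, lawMean (S.prob i) (S.q₀ i)

/-- The true variance of the statistic. -/
noncomputable def trueVar : ℝ := ∑ i, lawVar (S.prob i) (S.q₀ i)

theorem prob_mem_stdSimplex (i : Fin I) : S.prob i ∈ stdSimplex ℝ (Fin (S.n i)) :=
  ⟨S.prob_nonneg i, S.prob_sum i⟩

theorem prob_mem_sensitivityLaws {i : Fin I} {Γ : Bias} (h : S.trueBias i ≤ Γ) :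
    S.prob i ∈ sensitivityLaws (S.n i) Γ :=
  mem_sensitivityLaws_of_lawBias_le (S.prob_mem_stdSimplex i) h

theorem trueVar_nonneg : 0 ≤ S.trueVar :=
  Finset.sum_nonneg fun i _ => lawVar_nonneg (S.prob_mem_stdSimplex i) _

theorem div_cube_top (i : Fin I) (x : ℝ≥0∞) : x / ((S.n i : ℝ≥0∞) * ⊤) ^ 3 = 0 := by
  have : (S.n i : ℝ≥0∞) ≠ 0 := by
    have := S.two_le_n i
    exact_mod_cast (by omega : S.n i ≠ 0)
  rw [ENNReal.mul_top this, ENNReal.top_pow (by norm_num), ENNReal.div_top]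

theorem scaledRangeSum_trueBias_le :
    S.scaledRangeSum S.trueBias Finset.univ ≤ ENNReal.ofReal S.trueVar := by
  rw [trueVar, ENNReal.ofReal_sum_of_nonneg
    fun i _ => lawVar_nonneg (S.prob_mem_stdSimplex i) _]
  refine Finset.sum_le_sum fun i _ => ?_
  by_cases h : (S.trueBias i : ℝ≥0∞) = ⊤
  · rw [h, div_cube_top]
    exact zero_le
  · exact ofReal_sq_scoreRange_div_le (S.two_le_n i) h (S.prob_mem_sensitivityLaws le_rfl) _

theorem scaledRangeSum_const_le (Γ₀ : Bias) (s : Finset (Fin I)) :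
    S.scaledRangeSum (fun _ => Γ₀) s ≤ ENNReal.ofReal (∑ i ∈ s, maxVar (S.q₀ i) Γ₀) := by
  rw [ENNReal.ofReal_sum_of_nonneg fun i _ => maxVar_nonneg _ _]
  refine Finset.sum_le_sum fun i _ => ?_
  by_cases h : (Γ₀ : ℝ≥0∞) = ⊤
  · rw [h, div_cube_top]
    exact zero_le
  · obtain ⟨p, hp, hmax⟩ := exists_sensitivityLaws_maximizer
      (by have := S.two_le_n i; omega) Γ₀ h (S.q₀ i)
    exact (ofReal_sq_scoreRange_div_le (S.two_le_n i) h hp _).trans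
      (ENNReal.ofReal_le_ofReal (lawVar_le_maxVar hp hmax))

theorem lawMean_le_maxMean {Γ : Fin I → Bias} (hΓ : ∀ i, S.trueBias i ≤ Γ i) (i : Fin I) :
    lawMean (S.prob i) (S.q₀ i) ≤ maxMean (S.q₀ i) (Γ i) :=
  _root_.lawMean_le_maxMean (S.prob_mem_sensitivityLaws (hΓ i)) _

theorem trueMean_le_vecMean {Γ : Fin I → Bias} (hΓ : ∀ i, S.trueBias i ≤ Γ i) :
    S.trueMean ≤ vecMean S.q₀ Γ :=
  Finset.sum_le_sum fun i _ => S.lawMean_le_maxMean hΓ i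

theorem trueMean_add_le_vecMean_add {Γ : Fin I → Bias} (hΓ : ∀ i, S.trueBias i ≤ Γ i) {z : ℝ}
    (hz : 0 ≤ z) (hreg : ENNReal.ofReal z ≤ S.vecRegularity Γ) :
    S.trueMean + z * √S.trueVar ≤ vecMean S.q₀ Γ + z * √(vecVar S.q₀ Γ) := by
  refine add_mul_sqrt_le_add_mul_sqrt hz S.trueVar_nonneg (vecVar_nonneg _ _)
    (S.trueMean_le_vecMean hΓ) ?_
  set A := ∑ i ∈ S.varExcess Γ, (maxMean (S.q₀ i) (Γ i) - lawMean (S.prob i) (S.q₀ i)) with hA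
  set B := ∑ i ∈ S.varExcess Γ, (lawVar (S.prob i) (S.q₀ i) - maxVar (S.q₀ i) (Γ i)) with hB
  have hA0 : 0 ≤ A := Finset.sum_nonneg fun i _ => sub_nonneg.2 (S.lawMean_le_maxMean hΓ i)
  have hAle : A ≤ vecMean S.q₀ Γ - S.trueMean := by
    rw [vecMean, trueMean, ← Finset.sum_sub_distrib]
    exact Finset.sum_le_sum_of_subset_of_nonneg (Finset.subset_univ _)
      fun i _ _ => sub_nonneg.2 (S.lawMean_le_maxMean hΓ i)
  have hBle : S.trueVar - vecVar S.q₀ Γ ≤ B := by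
    rw [vecVar, trueVar, ← Finset.sum_sub_distrib, hB, varExcess, Finset.sum_filter]
    refine Finset.sum_le_sum fun i _ => ?_
    split_ifs with h
    · exact le_rfl
    · exact sub_nonpos.2 (not_lt.1 h)
  have hAB : z * B ≤ A * √S.trueVar := by
    by_cases he : S.varExcess Γ = ∅
    · simp [hA, hB, he]
    · have hne := Finset.nonempty_iff_ne_empty.2 he
      rw [vecRegularity, if_neg he, vecMeanDiff, vecVarDiff] at hreg
      refine mul_le_mul_sqrt_of_ofReal_le hA0 (Finset.sum_pos (fun i hi => ?_) hne)
        (by exact_mod_cast hne.card_pos.ne') S.trueVar_nonneg S.scaledRangeSum_trueBias_le hreg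
      rw [varExcess, Finset.mem_filter] at hi
      exact sub_pos.2 hi.2
  calc z * (S.trueVar - vecVar S.q₀ Γ) ≤ z * B := mul_le_mul_of_nonneg_left hBle hz
    _ ≤ A * √S.trueVar := hAB
    _ ≤ (vecMean S.q₀ Γ - S.trueMean) * √S.trueVar :=
        mul_le_mul_of_nonneg_right hAle (Real.sqrt_nonneg _)
    _ = _ := mul_comm _ _

theorem vecMean_add_le_vecMean_add {Γ₀ : Bias} {k : ℕ} {s t : Finset (Fin I)}
    (hs : IsWorstCaseSubset S.q₀ Γ₀ k s) (ht : t.card = k) {z : ℝ} (hz : 0 ≤ z)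
    (hreg : ENNReal.ofReal z ≤ S.quantRegularity Γ₀ s t) :
    vecMean S.q₀ (boundOn Γ₀ t) + z * √(vecVar S.q₀ (boundOn Γ₀ t)) ≤
      vecMean S.q₀ (boundOn Γ₀ s) + z * √(vecVar S.q₀ (boundOn Γ₀ s)) := by
  classical
  have hcard : s.card = t.card := hs.1.trans ht.symm
  rcases Nat.eq_zero_or_pos (s \ t).card with h0 | hpos
  · rw [eq_of_card_sdiff_eq_zero hcard h0]
  have hm : (0 : ℝ) < (s \ t).card := by exact_mod_cast hpos
  have hmean : vecMean S.q₀ (boundOn Γ₀ t) ≤ vecMean S.q₀ (boundOn Γ₀ s) := by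
    rw [hs.vecMean_eq, ← ht]
    exact vecMean_le_quantMean _ _ _
  refine add_mul_sqrt_le_add_mul_sqrt hz (vecVar_nonneg _ _) (vecVar_nonneg _ _) hmean ?_
  have hswap : S.swapPairs Γ₀ s t = ((s \ t) ×ˢ (t \ s)).filter
      (fun x => maxVar (S.q₀ x.1) Γ₀ < maxVar (S.q₀ x.2) Γ₀) := by
    unfold swapPairs
    congr!
  have hgap : ∀ x ∈ (s \ t) ×ˢ (t \ s), 0 ≤ meanGap (S.q₀ x.2) Γ₀ - meanGap (S.q₀ x.1) Γ₀ := by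
    intro x hx
    rw [Finset.mem_product, Finset.mem_sdiff, Finset.mem_sdiff] at hx
    exact sub_nonneg.2 (hs.meanGap_le hx.1.1 hx.2.2)
  set A := ∑ x ∈ S.swapPairs Γ₀ s t, (meanGap (S.q₀ x.2) Γ₀ - meanGap (S.q₀ x.1) Γ₀) with hA
  set B := ∑ x ∈ S.swapPairs Γ₀ s t, (maxVar (S.q₀ x.2) Γ₀ - maxVar (S.q₀ x.1) Γ₀) with hB
  set V := vecVar S.q₀ (boundOn Γ₀ t) with hV
  have hV0 : 0 ≤ V := vecVar_nonneg _ _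
  have hA0 : 0 ≤ A := Finset.sum_nonneg fun x hx =>
    hgap x (by rw [hswap] at hx; exact (Finset.mem_filter.1 hx).1)
  have hAle : A ≤ (s \ t).card *
      (vecMean S.q₀ (boundOn Γ₀ s) - vecMean S.q₀ (boundOn Γ₀ t)) := by
    rw [vecMean_boundOn, vecMean_boundOn, sub_sub_sub_cancel_left,
      ← sum_product_sdiff_sub (fun i => meanGap (S.q₀ i) Γ₀) hcard, hA, hswap]
    exact Finset.sum_le_sum_of_subset_of_nonneg (Finset.filter_subset _ _)
      fun x hx _ => hgap x hx
  have hBle : (s \ t).card * (V - vecVar S.q₀ (boundOn Γ₀ s)) ≤ B := by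
    rw [hV, vecVar_boundOn, vecVar_boundOn,
      ← sum_product_sdiff_sub (fun i => maxVar (S.q₀ i) Γ₀) hcard, hB, hswap, Finset.sum_filter]
    refine Finset.sum_le_sum fun x _ => ?_
    split_ifs with h
    · exact le_rfl
    · exact sub_nonpos.2 (not_lt.1 h)
  have hAB : z * B ≤ A * √V := by
    by_cases he : S.swapPairs Γ₀ s t = ∅
    · simp [hA, hB, he]
    · have hne := Finset.nonempty_iff_ne_empty.2 he
      rw [quantRegularity, if_neg he, quantMeanDiff, quantVarDiff] at hreg
      refine mul_le_mul_sqrt_of_ofReal_le hA0 (Finset.sum_pos (fun x hx => ?_) hne)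
        (by exact_mod_cast hne.card_pos.ne') hV0 ?_ hreg
      · rw [hswap, Finset.mem_filter] at hx
        exact sub_pos.2 hx.2
      · rw [hV, vecVar_boundOn]
        exact S.scaledRangeSum_const_le Γ₀ t
  -- Sums over pairs count the differences of means and of variances `(s \ t).card` times each; the
  -- factor cancels.
  refine le_of_mul_le_mul_left ?_ hm
  calc ((s \ t).card : ℝ) * (z * (V - vecVar S.q₀ (boundOn Γ₀ s)))
      = z * ((s \ t).card * (V - vecVar S.q₀ (boundOn Γ₀ s))) := by ring
    _ ≤ z * B := mul_le_mul_of_nonneg_left hBle hz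
    _ ≤ A * √V := hAB
    _ ≤ _ := mul_le_mul_of_nonneg_right hAle (Real.sqrt_nonneg _)
    _ = _ := by ring

theorem trueBias_le_boundOn {k : ℕ} (h1 : 1 ≤ k) (hk : k ≤ I) {s : Finset (Fin I)}
    (hs : S.IsLeastBiased k s) {Γ₀ : Bias} (hΓ : orderStat S.trueBias k ≤ Γ₀) (i : Fin I) :
    S.trueBias i ≤ boundOn Γ₀ s i := by
  unfold boundOn
  split_ifs with hi
  · exact S.trueBias_le_of_isLeastBiased h1 hk hs hΓ hi
  · exact Subtype.mk_le_mk.2 le_top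

theorem trueMean_add_le_quantMean_add {k : ℕ} (h1 : 1 ≤ k) (hk : k ≤ I) {s t : Finset (Fin I)}
    {Γ₀ : Bias} (ht : S.IsLeastBiased k t) (hΓ : orderStat S.trueBias k ≤ Γ₀)
    (hs : IsWorstCaseSubset S.q₀ Γ₀ k s) {z : ℝ} (hz : 0 ≤ z)
    (hvec : ENNReal.ofReal z ≤ S.vecRegularity (boundOn Γ₀ t))
    (hquant : ENNReal.ofReal z ≤ S.quantRegularity Γ₀ s t) :
    S.trueMean + z * √S.trueVar ≤ quantMean S.q₀ Γ₀ k + z * √(quantVar S.q₀ Γ₀ k) := by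
  refine (S.trueMean_add_le_vecMean_add (S.trueBias_le_boundOn h1 hk ht hΓ) hz hvec).trans
    ((S.vecMean_add_le_vecMean_add hs ht.1 hz hquant).trans ?_)
  have hvar : vecVar S.q₀ (boundOn Γ₀ s) ≤ quantVar S.q₀ Γ₀ k :=
    hs.1 ▸ vecVar_le_quantVar S.q₀ (hs.1.symm ▸ hs.vecMean_eq)
  rw [hs.vecMean_eq]
  gcongr

theorem trueMean_le_quantMean {k : ℕ} (h1 : 1 ≤ k) (hk : k ≤ I) {t : Finset (Fin I)}
    {Γ₀ : Bias} (ht : S.IsLeastBiased k t) (hΓ : orderStat S.trueBias k ≤ Γ₀) :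
    S.trueMean ≤ quantMean S.q₀ Γ₀ k :=
  (S.trueMean_le_vecMean (S.trueBias_le_boundOn h1 hk ht hΓ)).trans
    (ht.1 ▸ vecMean_le_quantMean _ _ _)

end MatchedStudy

/-! ### A central limit theorem for independent finitely supported variables -/

/-- Exchange the factors one at a time; the remaining factors have norm at most `1`. -/
theorem norm_prod_sub_prod_le_sum {ι : Type*} (s : Finset ι) {f g : ι → ℂ}
    (hf : ∀ i ∈ s, ‖f i‖ ≤ 1) (hg : ∀ i ∈ s, ‖g i‖ ≤ 1) :
    ‖∏ i ∈ s, f i - ∏ i ∈ s, g i‖ ≤ ∑ i ∈ s, ‖f i - g i‖ := by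
  classical
  induction s using Finset.induction_on with
  | empty => simp
  | insert a s ha ih =>
    rw [Finset.prod_insert ha, Finset.prod_insert ha, Finset.sum_insert ha]
    have hgs : ‖∏ i ∈ s, g i‖ ≤ 1 := by
      rw [norm_prod]
      exact Finset.prod_le_one (fun _ _ => norm_nonneg _)
        fun i hi => hg i (Finset.mem_insert_of_mem hi)
    calc ‖f a * ∏ i ∈ s, f i - g a * ∏ i ∈ s, g i‖
        = ‖(f a - g a) * ∏ i ∈ s, g i + f a * (∏ i ∈ s, f i - ∏ i ∈ s, g i)‖ := by
          congr 1
          ring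
      _ ≤ ‖f a - g a‖ * ‖∏ i ∈ s, g i‖ + ‖f a‖ * ‖∏ i ∈ s, f i - ∏ i ∈ s, g i‖ := by
          refine (norm_add_le _ _).trans ?_
          rw [norm_mul, norm_mul]
      _ ≤ ‖f a - g a‖ * 1 + 1 * ∑ i ∈ s, ‖f i - g i‖ := by
          gcongr
          · exact hf a (Finset.mem_insert_self a s)
          · exact ih (fun i hi => hf i (Finset.mem_insert_of_mem hi))
              fun i hi => hg i (Finset.mem_insert_of_mem hi)
      _ = _ := by ring

/-- The characteristic function of a variable that equals `x j` with probability `p j`. -/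
noncomputable def lawChar {n : ℕ} (p x : Fin n → ℝ) (t : ℝ) : ℂ :=
  ∑ j, (p j : ℂ) * Complex.exp (t * x j * Complex.I)

theorem norm_lawChar_le_one {n : ℕ} {p : Fin n → ℝ} (hp : p ∈ stdSimplex ℝ (Fin n))
    (x : Fin n → ℝ) (t : ℝ) : ‖lawChar p x t‖ ≤ 1 := by
  rw [← hp.2]
  refine norm_sum_le_of_le _ fun j _ => ?_
  rw [norm_mul, ← Complex.ofReal_mul, Complex.norm_exp_ofReal_mul_I, mul_one, Complex.norm_real,
    Real.norm_of_nonneg (hp.1 j)]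

theorem norm_exp_mul_I_sub_le {y : ℝ} (hy : |y| ≤ 1) :
    ‖Complex.exp (y * Complex.I) - (1 + y * Complex.I - y ^ 2 / 2)‖ ≤ |y| ^ 3 := by
  have hn : ‖(y : ℂ) * Complex.I‖ = |y| := by simp
  have h := Complex.exp_bound (x := y * Complex.I) (by rw [hn]; exact hy) (n := 3) (by norm_num)
  rw [hn] at h
  have heq : ∑ m ∈ Finset.range 3, ((y : ℂ) * Complex.I) ^ m / (m.factorial : ℂ) =
      1 + y * Complex.I - y ^ 2 / 2 := by
    simp [Finset.sum_range_succ, mul_pow, Complex.I_sq]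
    ring
  rw [heq] at h
  refine h.trans ?_
  have : (0 : ℝ) ≤ |y| ^ 3 := by positivity
  norm_num [Nat.factorial]
  nlinarith

/-- Both terms are compared with `1 - s t²/2`, where `s` is the variance. The bound `|x j| ≤ r`
turns the Taylor remainders into multiples of `s`, which can be summed over the matched sets. -/
theorem norm_lawChar_sub_gaussian_le {n : ℕ} {p : Fin n → ℝ} (hp : p ∈ stdSimplex ℝ (Fin n))
    {x : Fin n → ℝ} (hmean : ∑ j, p j * x j = 0) {r t : ℝ} (hx : ∀ j, |x j| ≤ r)
    (ht : |t| * r ≤ 1) :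
    ‖lawChar p x t - Complex.exp (-((∑ j, p j * x j ^ 2 : ℝ) * t ^ 2 / 2))‖ ≤
      (∑ j, p j * x j ^ 2) * (|t| ^ 3 * r + |t| ^ 4 * r ^ 2) := by
  have hne := stdSimplex_nonempty_index hp
  have hr : 0 ≤ r := (abs_nonneg _).trans (hx hne.some)
  set s := ∑ j, p j * x j ^ 2 with hs
  have hs0 : 0 ≤ s := Finset.sum_nonneg fun j _ => mul_nonneg (hp.1 j) (sq_nonneg _)
  have hsr : s ≤ r ^ 2 := by
    calc s ≤ ∑ j, p j * r ^ 2 := Finset.sum_le_sum fun j _ =>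
          mul_le_mul_of_nonneg_left (sq_le_sq' (abs_le.1 (hx j)).1 (abs_le.1 (hx j)).2) (hp.1 j)
      _ = r ^ 2 := by rw [← Finset.sum_mul, hp.2, one_mul]
  have htr0 : 0 ≤ |t| * r := by positivity
  have hst : s * t ^ 2 ≤ (|t| * r) ^ 2 := by
    rw [mul_pow, sq_abs, mul_comm]
    gcongr
  have h1 : ‖lawChar p x t - (1 - s * t ^ 2 / 2)‖ ≤ s * (|t| ^ 3 * r) := by
    have heq : lawChar p x t - (1 - s * t ^ 2 / 2) = ∑ j, (p j : ℂ) *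
        (Complex.exp (t * x j * Complex.I) - (1 + t * x j * Complex.I - (t * x j) ^ 2 / 2)) := by
      have e1 : (∑ j, (p j : ℂ)) = 1 := by exact_mod_cast hp.2
      have e2 : (∑ j, (p j : ℂ) * x j) = 0 := by exact_mod_cast hmean
      have e3 : (∑ j, (p j : ℂ) * x j ^ 2) = s := by
        rw [hs]
        push_cast
        rfl
      have e4 : ∑ j, (p j : ℂ) * (1 + t * x j * Complex.I - (t * x j) ^ 2 / 2) =
          (∑ j, (p j : ℂ)) + t * Complex.I * (∑ j, (p j : ℂ) * x j) -
            t ^ 2 / 2 * ∑ j, (p j : ℂ) * x j ^ 2 := by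
        rw [Finset.mul_sum, Finset.mul_sum, ← Finset.sum_add_distrib, ← Finset.sum_sub_distrib]
        exact Finset.sum_congr rfl fun j _ => by ring
      simp only [mul_sub (_ : ℂ) (Complex.exp _), Finset.sum_sub_distrib]
      rw [e4, e1, e2, e3, lawChar]
      ring
    rw [heq, hs, Finset.sum_mul]
    refine norm_sum_le_of_le _ fun j _ => ?_
    rw [norm_mul, Complex.norm_real, Real.norm_of_nonneg (hp.1 j), mul_assoc (p j)]
    refine mul_le_mul_of_nonneg_left ?_ (hp.1 j)
    have habs : |t * x j| ≤ 1 := by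
      rw [abs_mul]
      exact (mul_le_mul_of_nonneg_left (hx j) (abs_nonneg t)).trans ht
    have h := norm_exp_mul_I_sub_le habs
    push_cast at h
    refine h.trans ?_
    rw [abs_mul, mul_pow, ← sq_abs (x j)]
    have : |x j| ^ 3 ≤ |x j| ^ 2 * r := by
      rw [pow_succ]
      exact mul_le_mul_of_nonneg_left (hx j) (by positivity)
    calc |t| ^ 3 * |x j| ^ 3 ≤ |t| ^ 3 * (|x j| ^ 2 * r) :=
          mul_le_mul_of_nonneg_left this (by positivity)
      _ = _ := by ring
  have h2 : ‖Complex.exp (-(s * t ^ 2 / 2)) - (1 - s * t ^ 2 / 2)‖ ≤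
      s * (|t| ^ 4 * r ^ 2) := by
    have hnorm : ‖(-(s * t ^ 2 / 2) : ℂ)‖ = s * t ^ 2 / 2 := by
      rw [norm_neg, show (s * t ^ 2 / 2 : ℂ) = ((s * t ^ 2 / 2 : ℝ) : ℂ) by push_cast; rfl,
        Complex.norm_real, Real.norm_of_nonneg (by positivity)]
    have hle1 : s * t ^ 2 / 2 ≤ 1 := by nlinarith
    have h := Complex.norm_exp_sub_one_sub_id_le (x := -(s * t ^ 2 / 2)) (hnorm ▸ hle1)
    rw [hnorm] at h
    rw [show Complex.exp (-(s * t ^ 2 / 2)) - (1 - s * t ^ 2 / 2) =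
      Complex.exp (-(s * t ^ 2 / 2)) - 1 - -(s * t ^ 2 / 2) by ring]
    refine h.trans ?_
    have h4 : |t| ^ 4 = t ^ 2 * t ^ 2 := by rw [← sq_abs t]; ring
    rw [h4]
    have h5 : 0 ≤ s * (t ^ 2 * t ^ 2) := by positivity
    have h6 := mul_le_mul_of_nonneg_left hsr h5
    have h7 : 0 ≤ s * (t ^ 2 * t ^ 2) * s := by positivity
    nlinarith
  rw [mul_add]
  refine (norm_sub_le_norm_sub_add_norm_sub _ (1 - s * t ^ 2 / 2 : ℂ) _).trans (add_le_add h1 ?_)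
  rw [norm_sub_rev]
  exact h2

theorem norm_prod_lawChar_sub_gaussian_le {ι : Type*} [Fintype ι] {n : ι → ℕ}
    {p x : (i : ι) → Fin (n i) → ℝ} (hp : ∀ i, p i ∈ stdSimplex ℝ (Fin (n i)))
    (hmean : ∀ i, ∑ j, p i j * x i j = 0) (hvar : ∑ i, ∑ j, p i j * x i j ^ 2 = 1) {r t : ℝ}
    (hx : ∀ i j, |x i j| ≤ r) (ht : |t| * r ≤ 1) :
    ‖∏ i, lawChar (p i) (x i) t - Complex.exp (-(t ^ 2 / 2))‖ ≤
      |t| ^ 3 * r + |t| ^ 4 * r ^ 2 := by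
  have hexp : Complex.exp (-((t : ℂ) ^ 2 / 2)) =
      ∏ i, Complex.exp (-((∑ j, p i j * x i j ^ 2 : ℝ) * t ^ 2 / 2)) := by
    rw [← Complex.exp_sum, Finset.sum_neg_distrib, ← Finset.sum_div, ← Finset.sum_mul,
      ← Complex.ofReal_sum, hvar, Complex.ofReal_one, one_mul]
  rw [hexp]
  refine (norm_prod_sub_prod_le_sum _ (fun i _ => norm_lawChar_le_one (hp i) _ _)
    fun i _ => ?_).trans ?_
  · rw [Complex.norm_exp, Real.exp_le_one_iff]
    have h0 : 0 ≤ (∑ j, p i j * x i j ^ 2) * t ^ 2 / 2 :=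
      div_nonneg (mul_nonneg (Finset.sum_nonneg fun j _ => mul_nonneg ((hp i).1 j) (sq_nonneg _))
        (sq_nonneg t)) two_pos.le
    rw [show (-((∑ j, p i j * x i j ^ 2 : ℝ) * (t : ℂ) ^ 2 / 2)) =
      ((-((∑ j, p i j * x i j ^ 2) * t ^ 2 / 2) : ℝ) : ℂ) by push_cast; rfl, Complex.ofReal_re]
    linarith
  · calc _ ≤ ∑ i, (∑ j, p i j * x i j ^ 2) * (|t| ^ 3 * r + |t| ^ 4 * r ^ 2) :=
          Finset.sum_le_sum fun i _ => norm_lawChar_sub_gaussian_le (hp i) (hmean i) (hx i) ht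
      _ = _ := by rw [← Finset.sum_mul, hvar, one_mul]

/-! ### Finitely supported laws as measures on the real line. -/

section FiniteLaw

open MeasureTheory

variable {A : Type*} [Fintype A] (w f : A → ℝ)

/-- The law of a variable that equals `f a` with probability `w a`. -/
noncomputable def finiteLaw : Measure ℝ := ∑ a, ENNReal.ofReal (w a) • Measure.dirac (f a)

variable {w}

theorem isProbabilityMeasure_finiteLaw (hw : ∀ a, 0 ≤ w a) (hsum : ∑ a, w a = 1) :
    IsProbabilityMeasure (finiteLaw w f) := by
  refine ⟨?_⟩
  simp only [finiteLaw, Measure.finsetSum_apply, Measure.smul_apply, measure_univ, smul_eq_mul,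
    mul_one]
  rw [← ENNReal.ofReal_sum_of_nonneg fun a _ => hw a, hsum, ENNReal.ofReal_one]

open Classical in
theorem finiteLaw_apply (hw : ∀ a, 0 ≤ w a) {s : Set ℝ} (hs : MeasurableSet s) :
    finiteLaw w f s = ENNReal.ofReal (∑ a, if f a ∈ s then w a else 0) := by
  simp only [finiteLaw, Measure.finsetSum_apply, Measure.smul_apply, smul_eq_mul,
    Measure.dirac_apply' _ hs]
  rw [ENNReal.ofReal_sum_of_nonneg fun a _ => by split_ifs; exacts [hw a, le_rfl]]
  refine Finset.sum_congr rfl fun a _ => ?_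
  by_cases h : f a ∈ s <;> simp [h]

theorem charFun_finiteLaw (hw : ∀ a, 0 ≤ w a) (t : ℝ) :
    charFun (finiteLaw w f) t = ∑ a, (w a : ℂ) * Complex.exp (t * f a * Complex.I) := by
  rw [charFun_apply_real, finiteLaw, integral_finsetSum_measure]
  · refine Finset.sum_congr rfl fun a _ => ?_
    rw [integral_smul_measure, integral_dirac, ENNReal.toReal_ofReal (hw a), Complex.real_smul]
  · intro a _
    exact (integrable_dirac (by simp)).smul_measure ENNReal.ofReal_ne_top

end FiniteLaw

/-! ### Gaussian tails -/

section Gaussian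

open MeasureTheory ProbabilityTheory

theorem gaussianReal_real_Ici_eq (m : ℝ) {v : ℝ} (hv : 0 < v) (t : ℝ) :
    (gaussianReal m v.toNNReal).real (Set.Ici t) =
      (gaussianReal 0 1).real (Set.Ici ((t - m) / √v)) := by
  have hs : 0 < √v := Real.sqrt_pos.2 hv
  have hmap : (gaussianReal 0 1).map (fun x => √v * x + m) = gaussianReal m v.toNNReal := by
    rw [show (fun x : ℝ => √v * x + m) = (fun x => x + m) ∘ fun x => √v * x from rfl,
      ← Measure.map_map (by fun_prop) (by fun_prop), gaussianReal_map_const_mul,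
      gaussianReal_map_add_const]
    congr 1
    · ring
    · ext
      simp [Real.sq_sqrt hv.le, hv.le]
  rw [← hmap, measureReal_def, measureReal_def, Measure.map_apply (by fun_prop) measurableSet_Ici]
  congr 2
  ext x
  simp only [Set.mem_preimage, Set.mem_Ici]
  rw [div_le_iff₀ hs]
  constructor <;> intro h <;> linarith

theorem gaussianReal_real_Ici (x : ℝ) :
    (gaussianReal 0 1).real (Set.Ici x) = 1 - cdf (gaussianReal 0 1) x := by
  have := nullSingletonClass_gaussianReal (μ := 0) (v := 1) one_ne_zero
  rw [cdf_eq_real, ← probReal_compl_eq_one_sub measurableSet_Iic, Set.compl_Iic]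
  exact measureReal_congr Ioi_ae_eq_Ici.symm

/-- The smallest nonnegative point beyond which a standard Gaussian variable has probability at
most `α`. -/
theorem exists_gaussian_quantile {α : ℝ} (hα : 0 < α) :
    ∃ z, 0 ≤ z ∧ (gaussianReal 0 1).real (Set.Ici z) ≤ α ∧
      ∀ x, 0 ≤ x → (gaussianReal 0 1).real (Set.Ici x) ≤ α → z ≤ x := by
  set F := cdf (gaussianReal 0 1) with hF
  set s : Set ℝ := {x | 0 ≤ x ∧ 1 - F x ≤ α} with hs
  have hbdd : BddBelow s := ⟨0, fun x hx => hx.1⟩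
  have hne : s.Nonempty := by
    have h1 := ((tendsto_cdf_atTop (gaussianReal 0 1)).eventually_const_lt
      (show 1 - α < 1 by linarith)).and (eventually_ge_atTop (0 : ℝ))
    obtain ⟨x, hx, hx0⟩ := h1.exists
    exact ⟨x, hx0, by linarith⟩
  refine ⟨sInf s, le_csInf hne fun x hx => hx.1, ?_, fun x hx h => csInf_le hbdd ⟨hx, ?_⟩⟩
  · rw [gaussianReal_real_Ici]
    -- Right continuity of the distribution function shows that the infimum itself satisfies the
    -- tail bound.
    have hcont : Tendsto F (𝓝[>] sInf s) (𝓝 (F (sInf s))) :=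
      (F.right_continuous (sInf s)).mono_left (nhdsWithin_mono _ Set.Ioi_subset_Ici_self)
    have hev : ∀ᶠ x in 𝓝[>] sInf s, 1 - α ≤ F x := by
      filter_upwards [self_mem_nhdsWithin] with x hx
      obtain ⟨y, hy, hyx⟩ := exists_lt_of_csInf_lt hne hx
      have := F.mono hyx.le
      linarith [hy.2]
    have := ge_of_tendsto hcont hev
    linarith
  · rwa [gaussianReal_real_Ici] at h

end Gaussian

namespace MatchedStudy

variable {I : ℕ} (S : MatchedStudy I)

/-! ### The law of the statistic -/

theorem assignProb_eq (a : S.Assignment) : S.assignProb a = ∏ i, S.prob i (a i) := by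
  refine Finset.prod_congr rfl fun i _ => ?_
  rw [Finset.prod_eq_single (a i)]
  · simp [treat]
  · intro j _ hj
    simp [treat, hj.symm]
  · simp

theorem assignProb_nonneg (a : S.Assignment) : 0 ≤ S.assignProb a := by
  rw [assignProb_eq]
  exact Finset.prod_nonneg fun i _ => S.prob_nonneg i _

/-- Independence of the matched sets: expectations of products over the sets factor. -/
theorem sum_prod_assignment {R : Type*} [CommSemiring R] (f : (i : Fin I) → Fin (S.n i) → R) :
    ∑ a : S.Assignment, ∏ i, f i (a i) = ∏ i, ∑ j, f i j := by
  rw [Finset.prod_univ_sum, Fintype.piFinset_univ]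

theorem sum_assignProb : ∑ a, S.assignProb a = 1 := by
  simp only [assignProb_eq]
  rw [S.sum_prod_assignment]
  exact Finset.prod_eq_one fun i _ => S.prob_sum i

theorem P_mono {E F : Set S.Assignment} (h : E ⊆ F) : S.P E ≤ S.P F := by
  classical
  refine Finset.sum_le_sum fun a _ => ?_
  by_cases hE : a ∈ E
  · simp [hE, h hE]
  · rw [if_neg hE]
    split_ifs
    exacts [S.assignProb_nonneg a, le_rfl]

theorem P_compl (E : Set S.Assignment) : S.P Eᶜ = 1 - S.P E := by
  classical
  rw [eq_sub_iff_add_eq, ← S.sum_assignProb, P, P, ← Finset.sum_add_distrib]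
  refine Finset.sum_congr rfl fun a _ => ?_
  by_cases hE : a ∈ E <;> simp [hE]

theorem P_nonneg (E : Set S.Assignment) : 0 ≤ S.P E := by
  classical
  refine Finset.sum_nonneg fun a _ => ?_
  split_ifs
  exacts [S.assignProb_nonneg a, le_rfl]

theorem P_le_one (E : Set S.Assignment) : S.P E ≤ 1 := by
  have := S.P_compl E
  have := S.P_nonneg Eᶜ
  linarith

theorem observed_eq (h : S.FisherNull) (a : S.Assignment) : S.observed a = S.y₀ := by
  funext i j
  rw [observed, h i j]
  ring

theorem qObs_eq (h : S.FisherNull) (a : S.Assignment) : S.qObs a = S.q₀ := by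
  rw [qObs, S.observed_eq h, q₀]

theorem stat_eq (h : S.FisherNull) (a : S.Assignment) : S.stat a = ∑ i, S.q₀ i (a i) := by
  rw [stat, S.qObs_eq h]
  refine Finset.sum_congr rfl fun i _ => ?_
  simp [treat]

/-- The scores of a study, centered in each set and scaled by the standard deviation of the
statistic. -/
noncomputable def stdScore (i : Fin I) (j : Fin (S.n i)) : ℝ :=
  (S.q₀ i j - lawMean (S.prob i) (S.q₀ i)) / √S.trueVar

theorem sum_stdScore (a : S.Assignment) :
    ∑ i, S.stdScore i (a i) = (∑ i, S.q₀ i (a i) - S.trueMean) / √S.trueVar := by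
  simp only [stdScore, ← Finset.sum_div, Finset.sum_sub_distrib, trueMean]

open Classical in
/-- The law of the standardized statistic, replaced by the standard Gaussian law if the statistic
is constant. -/
noncomputable def stdLaw : MeasureTheory.Measure ℝ :=
  if 0 < S.trueVar then finiteLaw S.assignProb fun a => ∑ i, S.stdScore i (a i)
  else ProbabilityTheory.gaussianReal 0 1

instance : MeasureTheory.IsProbabilityMeasure S.stdLaw := by
  unfold stdLaw
  split_ifs
  · exact isProbabilityMeasure_finiteLaw _ S.assignProb_nonneg S.sum_assignProb
  · infer_instance

theorem charFun_stdLaw (hv : 0 < S.trueVar) (t : ℝ) :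
    MeasureTheory.charFun S.stdLaw t = ∏ i, lawChar (S.prob i) (S.stdScore i) t := by
  rw [stdLaw, if_pos hv, charFun_finiteLaw _ S.assignProb_nonneg]
  simp only [lawChar]
  rw [← S.sum_prod_assignment]
  refine Finset.sum_congr rfl fun a _ => ?_
  rw [Finset.prod_mul_distrib, ← Complex.exp_sum, S.assignProb_eq, Complex.ofReal_prod,
    ← Finset.sum_mul, Complex.ofReal_sum, Finset.mul_sum]

theorem stdLaw_Ici (hv : 0 < S.trueVar) (z : ℝ) :
    S.stdLaw (Set.Ici z) = ENNReal.ofReal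
      (S.P {a | S.trueMean + z * √S.trueVar ≤ ∑ i, S.q₀ i (a i)}) := by
  classical
  rw [stdLaw, if_pos hv, finiteLaw_apply _ S.assignProb_nonneg measurableSet_Ici, P]
  congr 1
  refine Finset.sum_congr rfl fun a _ => ?_
  congr 1
  rw [S.sum_stdScore, Set.mem_Ici, le_div_iff₀ (Real.sqrt_pos.2 hv), Set.mem_ofPred_eq]
  exact propext ⟨fun h => by linarith, fun h => by linarith⟩

theorem sum_prob_mul_stdScore (i : Fin I) : ∑ j, S.prob i j * S.stdScore i j = 0 := by
  simp only [stdScore, mul_div_assoc', ← Finset.sum_div, mul_sub, Finset.sum_sub_distrib,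
    ← Finset.sum_mul, S.prob_sum, one_mul]
  rw [lawMean, sub_self, zero_div]

theorem sum_prob_mul_sq_stdScore (hv : 0 < S.trueVar) :
    ∑ i, ∑ j, S.prob i j * S.stdScore i j ^ 2 = 1 := by
  simp only [stdScore, div_pow, Real.sq_sqrt hv.le, mul_div_assoc', ← Finset.sum_div]
  exact div_self hv.ne'

/-- The ratio of the largest squared range to the scaled sum of squared ranges. -/
noncomputable def rangeRatio : ℝ≥0∞ :=
  (⨆ i, S.rangeSq i) / S.scaledRangeSum S.trueBias Finset.univ

/-- A finite ratio also covers a zero denominator: `0/0 = 0` is the only finite possibility, and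
then all ranges vanish. -/
theorem sq_scoreRange_le (h : S.rangeRatio ≠ ⊤) (i : Fin I) :
    scoreRange (S.q₀ i) ^ 2 ≤ S.rangeRatio.toReal * S.trueVar := by
  have hfin : S.scaledRangeSum S.trueBias Finset.univ ≠ ⊤ :=
    ne_top_of_le_ne_top ENNReal.ofReal_ne_top S.scaledRangeSum_trueBias_le
  have h1 : S.rangeSq i ≤ S.rangeRatio * ENNReal.ofReal S.trueVar := by
    refine (le_iSup S.rangeSq i).trans (le_trans ?_
      (mul_le_mul_right S.scaledRangeSum_trueBias_le S.rangeRatio))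
    rw [← ENNReal.div_le_iff_le_mul (Or.inr h) (Or.inl hfin)]
    exact le_rfl
  rw [← ENNReal.ofReal_toReal h, ← ENNReal.ofReal_mul ENNReal.toReal_nonneg, rangeSq] at h1
  exact (ENNReal.ofReal_le_ofReal_iff
    (mul_nonneg ENNReal.toReal_nonneg S.trueVar_nonneg)).1 h1

theorem abs_stdScore_le (hv : 0 < S.trueVar) (h : S.rangeRatio ≠ ⊤) (i : Fin I)
    (j : Fin (S.n i)) : |S.stdScore i j| ≤ √S.rangeRatio.toReal := by
  rw [stdScore, abs_div, abs_of_pos (Real.sqrt_pos.2 hv), div_le_iff₀ (Real.sqrt_pos.2 hv),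
    ← Real.sqrt_mul ENNReal.toReal_nonneg]
  exact (abs_sub_lawMean_le (S.prob_mem_stdSimplex i) _ j).trans
    (Real.le_sqrt_of_sq_le (S.sq_scoreRange_le h i))

theorem norm_charFun_stdLaw_sub_le (h : S.rangeRatio ≠ ⊤) {t : ℝ}
    (ht : |t| * √S.rangeRatio.toReal ≤ 1) :
    ‖MeasureTheory.charFun S.stdLaw t - Complex.exp (-(t ^ 2 / 2))‖ ≤
      |t| ^ 3 * √S.rangeRatio.toReal + |t| ^ 4 * √S.rangeRatio.toReal ^ 2 := by
  by_cases hv : 0 < S.trueVar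
  · rw [S.charFun_stdLaw hv]
    exact norm_prod_lawChar_sub_gaussian_le S.prob_mem_stdSimplex S.sum_prob_mul_stdScore
      (S.sum_prob_mul_sq_stdScore hv) (S.abs_stdScore_le hv h) ht
  · rw [stdLaw, if_neg hv, ProbabilityTheory.charFun_gaussianReal]
    simp only [Complex.ofReal_zero, mul_zero, zero_mul, NNReal.coe_one, Complex.ofReal_one, one_mul,
      zero_sub, sub_self, norm_zero]
    positivity

/-! ### Rejected null hypotheses -/

theorem eq_of_scoreRange_eq_zero {n : ℕ} {q : Fin n → ℝ} (h : scoreRange q = 0)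
    {p : Fin n → ℝ} (hp : p ∈ stdSimplex ℝ (Fin n)) (j : Fin n) : q j = lawMean p q := by
  have := abs_sub_lawMean_le hp q j
  rw [h] at this
  exact sub_eq_zero.1 (abs_nonpos_iff.1 this)

theorem quantVar_nonpos {n : Fin I → ℕ} {q : Scores n} (h : ∀ i, scoreRange (q i) = 0)
    (Γ₀ : Bias) (k : ℕ) : quantVar q Γ₀ k ≤ 0 := by
  refine Real.sSup_le ?_ le_rfl
  rintro _ ⟨s, -, -, rfl⟩
  refine Finset.sum_nonpos fun i _ => ?_
  have := maxVar_le_sq_scoreRange (q i) (boundOn Γ₀ s i)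
  rw [h i] at this
  simpa using this

/-- A rejected hypothesis that holds forces the statistic beyond the true quantile. -/
theorem trueMean_add_le_of_quantPValue_le {kLow : ℕ} {ΓHigh : ℝ≥0∞} {α z : ℝ} (hα : α < 1)
    (hz0 : 0 ≤ z) (hz : ∀ x, 0 ≤ x →
      (ProbabilityTheory.gaussianReal 0 1).real (Set.Ici x) ≤ α → z ≤ x)
    (hratio : S.rangeRatio ≠ ⊤)
    {k : ℕ} {Γ₀ : Bias} (hr : S.InRange kLow ΓHigh k Γ₀) {s t : Finset (Fin I)}
    (ht : S.IsLeastBiased k t) (hs : IsWorstCaseSubset S.q₀ Γ₀ k s)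
    (hvec : ENNReal.ofReal z ≤ S.vecRegularity (boundOn Γ₀ t))
    (hquant : ENNReal.ofReal z ≤ S.quantRegularity Γ₀ s t) (a : S.Assignment)
    (hp : quantPValue S.q₀ (∑ i, S.q₀ i (a i)) Γ₀ k ≤ α) :
    0 < S.trueVar ∧ S.trueMean + z * √S.trueVar ≤ ∑ i, S.q₀ i (a i) := by
  obtain ⟨h1, -, hk, hΓ, -⟩ := hr
  have hle : quantMean S.q₀ Γ₀ k ≤ ∑ i, S.q₀ i (a i) := by
    by_contra hn
    rw [quantPValue, if_neg hn] at hp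
    linarith
  rw [quantPValue, if_pos hle] at hp
  constructor
  · refine S.trueVar_nonneg.lt_of_ne' fun h0 => ?_
    have hR : ∀ i, scoreRange (S.q₀ i) = 0 := fun i => by
      have := S.sq_scoreRange_le hratio i
      rw [h0, mul_zero] at this
      exact pow_eq_zero_iff (two_ne_zero) |>.1 (le_antisymm this (sq_nonneg _))
    have hT : ∑ i, S.q₀ i (a i) = S.trueMean := Finset.sum_congr rfl fun i _ =>
      eq_of_scoreRange_eq_zero (hR i) (S.prob_mem_stdSimplex i) _
    have hge := S.trueMean_le_quantMean h1 hk ht hΓ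
    have heq : quantMean S.q₀ Γ₀ k = ∑ i, S.q₀ i (a i) := le_antisymm hle (hT ▸ hge)
    rw [Real.toNNReal_of_nonpos (quantVar_nonpos hR Γ₀ k), heq,
      ProbabilityTheory.gaussianReal_zero_var, MeasureTheory.measureReal_def,
      MeasureTheory.Measure.dirac_apply' _ measurableSet_Ici] at hp
    simp only [Set.mem_Ici, le_refl, Set.indicator_of_mem, Pi.one_apply, ENNReal.toReal_one] at hp
    linarith
  · refine (S.trueMean_add_le_quantMean_add h1 hk ht hΓ hs hz0 hvec hquant).trans ?_
    rcases le_or_gt (quantVar S.q₀ Γ₀ k) 0 with hv | hv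
    · rw [Real.sqrt_eq_zero_of_nonpos hv, mul_zero, add_zero]
      exact hle
    · rw [gaussianReal_real_Ici_eq _ hv] at hp
      have hsq := Real.sqrt_pos.2 hv
      have := hz _ (div_nonneg (sub_nonneg.2 hle) hsq.le) hp
      rw [le_div_iff₀ hsq] at this
      linarith

end MatchedStudy

/-! ### Coverage -/

theorem tendsto_charFun_stdLaw {S : (I : ℕ) → MatchedStudy I}
    (h : Tendsto (fun I => (S I).rangeRatio) atTop (𝓝 0)) (t : ℝ) :
    Tendsto (fun I => MeasureTheory.charFun (S I).stdLaw t) atTop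
      (𝓝 (MeasureTheory.charFun (ProbabilityTheory.gaussianReal 0 1) t)) := by
  have hr : Tendsto (fun I => √(S I).rangeRatio.toReal) atTop (𝓝 0) := by
    have := (Real.continuous_sqrt.tendsto 0).comp
      ((ENNReal.tendsto_toReal ENNReal.zero_ne_top).comp h)
    simpa [Function.comp_def] using this
  have hchar : MeasureTheory.charFun (ProbabilityTheory.gaussianReal 0 1) t =
      Complex.exp (-(t ^ 2 / 2)) := by
    rw [ProbabilityTheory.charFun_gaussianReal]
    simp
  have hbound : Tendsto (fun I => |t| ^ 3 * √(S I).rangeRatio.toReal +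
      |t| ^ 4 * √(S I).rangeRatio.toReal ^ 2) atTop (𝓝 0) := by
    simpa using (hr.const_mul (|t| ^ 3)).add ((hr.pow 2).const_mul (|t| ^ 4))
  have hsmall : ∀ᶠ I in atTop, |t| * √(S I).rangeRatio.toReal ≤ 1 := by
    have := hr.const_mul |t|
    rw [mul_zero] at this
    exact this.eventually_le_const one_pos
  rw [hchar, tendsto_iff_norm_sub_tendsto_zero]
  refine squeeze_zero' (Eventually.of_forall fun I => norm_nonneg _) ?_ hbound
  filter_upwards [hsmall, h.eventually_ne ENNReal.zero_ne_top] with I h1 h2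
  exact (S I).norm_charFun_stdLaw_sub_le h2 h1

/-- Lévy's continuity theorem gives weak convergence, and the portmanteau theorem for closed sets
gives the bound. -/
theorem limsup_stdLaw_Ici_le {S : (I : ℕ) → MatchedStudy I}
    (h : Tendsto (fun I => (S I).rangeRatio) atTop (𝓝 0)) (z : ℝ) :
    limsup (fun I => (S I).stdLaw (Set.Ici z)) atTop ≤
      ProbabilityTheory.gaussianReal 0 1 (Set.Ici z) := by
  have hlim : Tendsto (β := MeasureTheory.ProbabilityMeasure ℝ)
      (fun I => ⟨(S I).stdLaw, inferInstance⟩) atTop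
      (𝓝 (⟨ProbabilityTheory.gaussianReal 0 1, inferInstance⟩ :
        MeasureTheory.ProbabilityMeasure ℝ)) :=
    MeasureTheory.ProbabilityMeasure.tendsto_iff_tendsto_charFun.2 (tendsto_charFun_stdLaw h)
  exact MeasureTheory.ProbabilityMeasure.limsup_measure_closed_le_of_tendsto hlim isClosed_Ici

theorem liminf_jointRegion_ge {S : (I : ℕ) → MatchedStudy I} {kLow : ℕ → ℕ} {ΓHigh : ℕ → ℝ≥0∞}
    {leastBiased : (I : ℕ) → ℕ → Finset (Fin I)}
    (hleast : ∀ I k, 1 ≤ k → k ≤ I → (S I).IsLeastBiased k (leastBiased I k))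
    {worst : (I : ℕ) → Bias → ℕ → Finset (Fin I)}
    (hworst : ∀ I Γ₀ k, 1 ≤ k → k ≤ I → IsWorstCaseSubset (S I).q₀ Γ₀ k (worst I Γ₀ k))
    (hnull : ∀ I, (S I).FisherNull)
    (hreg : UniformRegularity S kLow ΓHigh leastBiased worst)
    {α : ℝ} (hα₀ : 0 < α) (hα₁ : α < 1) :
    1 - α ≤ liminf (fun I =>
      (S I).P {a | (S I).trueBias ∈ (S I).jointRegion (kLow I) (ΓHigh I) α a}) atTop := by
  obtain ⟨z, hz0, hzα, hz⟩ := exists_gaussian_quantile hα₀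
  have hratio : Tendsto (fun I => (S I).rangeRatio) atTop (𝓝 0) := hreg.clt
  refine le_of_forall_pos_le_add fun ε hε => ?_
  rw [← sub_le_iff_le_add]
  refine le_liminf_of_le ((isBoundedUnder_of ⟨1, fun I => (S I).P_le_one _⟩).isCoboundedUnder_ge) ?_
  have hlaw : ∀ᶠ I in atTop, (S I).stdLaw (Set.Ici z) < ENNReal.ofReal (α + ε) := by
    refine eventually_lt_of_limsup_lt ((limsup_stdLaw_Ici_le hratio z).trans_lt ?_)
    rw [← MeasureTheory.ofReal_measureReal]
    exact (ENNReal.ofReal_lt_ofReal_iff (by linarith)).2 (by linarith)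
  -- The infima over all `(k, Γ₀)` in range tend to infinity, so from some `I` on they exceed the
  -- fixed `z` for all true nulls at once.
  have hvec := hreg.vec.eventually_const_lt (ENNReal.ofReal_lt_top (r := z))
  have hquant := hreg.quant.eventually_const_lt (ENNReal.ofReal_lt_top (r := z))
  filter_upwards [hlaw, hvec, hquant, hratio.eventually_ne ENNReal.zero_ne_top]
    with I hlaw hvec hquant hfin
  set E : Set (S I).Assignment :=
    {a | (S I).trueBias ∈ (S I).jointRegion (kLow I) (ΓHigh I) α a} with hE
  have hrej : ∀ a ∈ Eᶜ, 0 < (S I).trueVar ∧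
      (S I).trueMean + z * √(S I).trueVar ≤ ∑ i, (S I).q₀ i (a i) := by
    intro a ha
    rw [hE, Set.mem_compl_iff, Set.mem_ofPred_eq, MatchedStudy.mem_jointRegion] at ha
    push Not at ha
    obtain ⟨k, h1, hk, Γ₀, hp, hΓ⟩ := ha
    -- Outside the cutoffs the `p`-value is `1`, so a rejected true null lies in the range of the
    -- infima.
    by_cases hc : (Γ₀ : ℝ≥0∞) ≤ ΓHigh I ∧ kLow I ≤ k ∧ 1 ≤ k
    · have hr : (S I).InRange (kLow I) (ΓHigh I) k Γ₀ := ⟨h1, hc.2.1, hk, hΓ, hc.1⟩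
      rw [MatchedStudy.pMod, if_pos hc, (S I).qObs_eq (hnull I), (S I).stat_eq (hnull I)] at hp
      exact (S I).trueMean_add_le_of_quantPValue_le hα₁ hz0 hz hfin hr (hleast I k h1 hk)
        (hworst I Γ₀ k h1 hk) (hvec.le.trans (iInf₂_le_of_le k Γ₀ (iInf_le _ hr)))
        (hquant.le.trans (iInf₂_le_of_le k Γ₀ (iInf_le _ hr))) a hp
    · rw [MatchedStudy.pMod, if_neg hc] at hp
      linarith
  have hPc : (S I).P Eᶜ ≤ α + ε := by
    by_cases hv : 0 < (S I).trueVar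
    · rw [(S I).stdLaw_Ici hv] at hlaw
      refine ((S I).P_mono fun a ha => (hrej a ha).2).trans ?_
      exact ((ENNReal.ofReal_lt_ofReal_iff (by linarith)).1 hlaw).le
    · have hempty : Eᶜ = ∅ := Set.eq_empty_of_forall_notMem fun a ha => hv (hrej a ha).1
      rw [hempty, MatchedStudy.P]
      simp only [Set.mem_empty_iff_false, if_false, Finset.sum_const_zero]
      linarith
  rw [(S I).P_compl] at hPc
  linarith

theorem theoremA1
    (S : (I : ℕ) → MatchedStudy I) (kLow : ℕ → ℕ) (ΓHigh : ℕ → ℝ≥0∞)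
    (leastBiased : (I : ℕ) → ℕ → Finset (Fin I))
    (hleast : ∀ I k, 1 ≤ k → k ≤ I → (S I).IsLeastBiased k (leastBiased I k))
    (worst : (I : ℕ) → Bias → ℕ → Finset (Fin I))
    (hworst : ∀ I Γ₀ k, 1 ≤ k → k ≤ I → IsWorstCaseSubset (S I).q₀ Γ₀ k (worst I Γ₀ k))
    (hnull : ∀ I, (S I).FisherNull)
    (hreg : UniformRegularity S kLow ΓHigh leastBiased worst)
    (α : ℝ) (hα₀ : 0 < α) (hα₁ : α < 1) :
    -- the intersections over all ranks, over all thresholds, and over both, are the same set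
    (∀ (I : ℕ) (a : (S I).Assignment),
      (⋂ k ∈ Finset.Icc 1 I, (S I).quantileRegion (kLow I) (ΓHigh I) α a k) =
          ⋂ Γ₀ : Bias, (S I).countRegion (kLow I) (ΓHigh I) α a Γ₀ ∧
      (⋂ k ∈ Finset.Icc 1 I, (S I).quantileRegion (kLow I) (ΓHigh I) α a k) =
          (S I).jointRegion (kLow I) (ΓHigh I) α a) ∧
    -- each set for a rank, as a set for the bias vector
    (∀ (I : ℕ) (a : (S I).Assignment), ∀ k ∈ Finset.Icc 1 I,
      (S I).quantileRegion (kLow I) (ΓHigh I) α a k ⊆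
          {Γ | orderStat Γ k ∈ (S I).quantileCI (kLow I) (ΓHigh I) α a k} ∧
      (Monotone (fun Γ₀ => (S I).pMod (kLow I) (ΓHigh I) a Γ₀ k) →
        (S I).quantileRegion (kLow I) (ΓHigh I) α a k =
          {Γ | orderStat Γ k ∈ (S I).quantileCI (kLow I) (ΓHigh I) α a k})) ∧
    -- each set for a threshold, as a set for the bias vector
    (∀ (I : ℕ) (a : (S I).Assignment) (Γ₀ : Bias),
      (S I).countRegion (kLow I) (ΓHigh I) α a Γ₀ ⊆
          {Γ | exceedCount Γ Γ₀ ∈ (S I).countCI (kLow I) (ΓHigh I) α a Γ₀} ∧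
      (AntitoneOn (fun k => (S I).pMod (kLow I) (ΓHigh I) a Γ₀ k) (Set.Iic I) →
        (S I).countRegion (kLow I) (ΓHigh I) α a Γ₀ =
          {Γ | exceedCount Γ Γ₀ ∈ (S I).countCI (kLow I) (ΓHigh I) α a Γ₀})) ∧
    -- the asymptotic coverage of the true bias vector
    1 - α ≤ liminf (fun I =>
      (S I).P {a | (S I).trueBias ∈ (S I).jointRegion (kLow I) (ΓHigh I) α a}) atTop := by
  refine ⟨fun I a => ⟨?_, ?_⟩, fun I a k _ => ⟨?_, ?_⟩, fun I a Γ₀ => ⟨?_, ?_⟩,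
    liminf_jointRegion_ge hleast hworst hnull hreg hα₀ hα₁⟩
  · rw [MatchedStudy.iInter_quantileRegion_eq_jointRegion,
      MatchedStudy.iInter_countRegion_eq_jointRegion]
  · exact (S I).iInter_quantileRegion_eq_jointRegion
  · exact (S I).quantileRegion_subset k
  · exact (S I).quantileRegion_eq_of_monotone
  · exact (S I).countRegion_subset hα₁ Γ₀
  · exact (S I).countRegion_eq_of_antitoneOn hα₁
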